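/- \textbf{Proposition (Young inequality for the index Whittaker convolution).} For real $\alpha,\nu$ let $W_{\alpha,\nu}$ be the Whittaker function on $(0,\infty)$, i.e. the unique solution of $u''+\bigl(-\tfrac14+\tfrac{\alpha}{x}+\tfrac{1/4-\nu^2}{x^2}\bigr)u=0$ with $u(x)\sim x^{\alpha}e^{-x/2}$ as $x\to\infty$, and let $$D_\mu(z)=2^{\frac{\mu}{2}+\frac14}\,z^{-\frac12}\,W_{\frac{\mu}{2}+\frac14,\frac14}\bigl(\tfrac{z^2}{2}\bigr)\qquad(z>0)$$ be the parabolic cylinder function. For $a\ge 0$ and $x,y,\xi>0$ put $\mathrm m_a(\xi)=\xi^{-2a-1}e^{-\xi}$ and $$q_a(x,y,\xi)=2^{-\frac32+a}\pi^{-\frac12}(xy\xi)^a\exp\Bigl(x+y+\xi-\frac{(xy+x\xi+y\xi)^2}{8xy\xi}\Bigr)D_{1-2a}\Bigl(\frac{xy+x\xi+y\xi}{(2xy\xi)^{1/2}}\Bigr).$$ For $1\le p\le\infty$ let $L_p^a=L_p\bigl((0,\infty);\mathrm m_a(x)\,dx\bigr)$ (complex-valued functions), with norm $\|\cdot\|_{p,a}$.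 The convolution of $f,g:(0,\infty)\to\mathbb C$ is $$(f*_a g)(x)=\int_0^\infty\!\int_0^\infty q_a(x,y,\xi)\,f(y)\,g(\xi)\,\mathrm m_a(y)\,dy\,\mathrm m_a(\xi)\,d\xi ,$$ and it is said to be well defined if this double integral exists, as an absolutely convergent Lebesgue integral over $(0,\infty)^2$, for almost every $x>0$. Let $a\ge0$ and let $p_1,p_2\in[1,\infty]$ satisfy $\frac1{p_1}+\frac1{p_2}\ge1$. Let $r\in[1,\infty]$ be defined by $\frac1r=\frac1{p_1}+\frac1{p_2}-1$ (with $\frac1\infty=0$). If $f\in L_{p_1}^a$ and $g\in L_{p_2}^a$, then $f*_a g$ is well defined, $f*_a g\in L_r^a$, and $$\|f*_a g\|_{r,a}\le\|f\|_{p_1,a}\,\|g\|_{p_2,a}.$$ -/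

import Mathlib

open MeasureTheory Set Filter Topology
open scoped ENNReal

/-- `u` is the Whittaker function `W_{α,ν}` of the half-line `(0, ∞)` (real parameters): it solves
Whittaker's equation `u'' + (-1/4 + α/x + (1/4 - ν²)/x²) u = 0` on `(0, ∞)` and satisfies
`u(x) ~ x^α e^{-x/2}` as `x → ∞`. These two properties determine `u` on `(0, ∞)`; for definiteness
it is put equal to `0` elsewhere. -/
structure IsWhittakerW (α ν : ℝ) (u : ℝ → ℝ) : Prop where
  differentiableAt : ∀ x, 0 < x → DifferentiableAt ℝ u x
  differentiableAt_deriv : ∀ x, 0 < x → DifferentiableAt ℝ (deriv u) x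
  ode : ∀ x, 0 < x →
    deriv (deriv u) x + (-(1 / 4) + α / x + (1 / 4 - ν ^ 2) / x ^ 2) * u x = 0
  asymp : Asymptotics.IsEquivalent atTop u (fun x => x ^ α * Real.exp (-x / 2))
  eq_zero : ∀ x, x ≤ 0 → u x = 0

/-- The Whittaker function `W_{α,ν}` on `(0, ∞)`, for real parameters. -/
noncomputable def whittakerW (α ν : ℝ) : ℝ → ℝ :=
  Classical.epsilon (IsWhittakerW α ν)

/-- The Whittaker function is unique. -/
theorem IsWhittakerW.unique {α ν : ℝ} {u v : ℝ → ℝ}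
    (hu : IsWhittakerW α ν u) (hv : IsWhittakerW α ν v) : u = v := by
  set Q : ℝ → ℝ := fun x => -(-(1 / 4) + α / x + (1 / 4 - ν ^ 2) / x ^ 2) with hQ
  set w : ℝ → ℝ := fun x => u x - v x with hw
  set w' : ℝ → ℝ := fun x => deriv u x - deriv v x with hw'
  have du : ∀ x, 0 < x → HasDerivAt u (deriv u x) x := fun x hx =>
    (hu.differentiableAt x hx).hasDerivAt
  have du' : ∀ x, 0 < x → HasDerivAt (deriv u) (Q x * u x) x := fun x hx => by
    refine (hu.differentiableAt_deriv x hx).hasDerivAt.congr_deriv ?_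
    have e := hu.ode x hx
    simp only [hQ]; linarith
  have dv : ∀ x, 0 < x → HasDerivAt v (deriv v x) x := fun x hx =>
    (hv.differentiableAt x hx).hasDerivAt
  have dv' : ∀ x, 0 < x → HasDerivAt (deriv v) (Q x * v x) x := fun x hx => by
    refine (hv.differentiableAt_deriv x hx).hasDerivAt.congr_deriv ?_
    have e := hv.ode x hx
    simp only [hQ]; linarith
  have dw : ∀ x, 0 < x → HasDerivAt w (w' x) x := fun x hx => (du x hx).sub (dv x hx)
  have dw' : ∀ x, 0 < x → HasDerivAt w' (Q x * w x) x := fun x hx => by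
    refine ((du' x hx).sub (dv' x hx)).congr_deriv ?_
    simp only [hw]; ring
  have huv : Asymptotics.IsEquivalent atTop v u := hv.asymp.trans hu.asymp.symm
  have hwo : w =o[atTop] u := by
    have := huv.isLittleO.neg_left
    refine this.congr_left fun x => ?_
    simp [hw]
  have hh0 : Tendsto (fun x : ℝ => x ^ α * Real.exp (-x / 2)) atTop (𝓝 0) := by
    have := tendsto_rpow_mul_exp_neg_mul_atTop_nhds_zero α (1 / 2) (by norm_num)
    refine this.congr fun x => ?_
    congr 2; ring
  have hu0 : Tendsto u atTop (𝓝 0) := hu.asymp.symm.tendsto_nhds hh0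
  have hupos : ∀ᶠ x in atTop, 0 < u x := by
    obtain ⟨φ, hφ, e⟩ := hu.asymp.exists_eq_mul
    filter_upwards [hφ.eventually (lt_mem_nhds (zero_lt_one)), e, eventually_gt_atTop (0 : ℝ)]
      with x h1 h2 h3
    rw [h2]
    exact mul_pos h1 (mul_pos (Real.rpow_pos_of_pos h3 _) (Real.exp_pos _))
  have hult : ∀ᶠ x in atTop, u x < 1 := hu0.eventually (gt_mem_nhds zero_lt_one)
  obtain ⟨X, hX⟩ := eventually_atTop.1 ((hupos.and hult).and (eventually_gt_atTop (0 : ℝ)))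
  have hX0 : ∀ x, X ≤ x → 0 < x := fun x hx => (hX x hx).2
  have hXu : ∀ x, X ≤ x → 0 < u x := fun x hx => (hX x hx).1.1
  have hXl : ∀ x, X ≤ x → u x < 1 := fun x hx => (hX x hx).1.2
  set Wr : ℝ → ℝ := fun x => w' x * u x - w x * deriv u x with hWr
  have dWr : ∀ x, 0 < x → HasDerivAt Wr 0 x := fun x hx => by
    refine (((dw' x hx).mul (du x hx)).sub ((dw x hx).mul (du' x hx))).congr_deriv ?_
    ring
  have const : ∀ (f f' : ℝ → ℝ), (∀ x, X ≤ x → HasDerivAt f (f' x) x) → ∀ x y, X ≤ x → x < y →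
      ∃ z, X ≤ z ∧ f y - f x = f' z * (y - x) := by
    intro f f' hf x y hx hxy
    obtain ⟨z, hz, e⟩ := exists_hasDerivAt_eq_slope f f' hxy
      (fun t ht => (hf t (hx.trans ht.1)).continuousAt.continuousWithinAt)
      (fun t ht => hf t (hx.trans ht.1.le))
    refine ⟨z, hx.trans hz.1.le, ?_⟩
    rw [e]; field_simp [(sub_pos.2 hxy).ne']
  have hWrc : ∀ x, X ≤ x → Wr x = Wr X := by
    intro x hx
    rcases hx.eq_or_lt with rfl | h
    · rfl
    obtain ⟨z, -, e⟩ := const Wr (fun _ => 0) (fun t ht => dWr t (hX0 t ht)) X x le_rfl h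
    linarith
  set φ : ℝ → ℝ := fun x => w x / u x with hφ
  have hφ0 : Tendsto φ atTop (𝓝 0) := hwo.tendsto_div_nhds_zero
  have dφ : ∀ x, X ≤ x → HasDerivAt φ (Wr X / u x ^ 2) x := fun x hx => by
    rw [← hWrc x hx]
    exact (dw x (hX0 x hx)).div (du x (hX0 x hx)) (hXu x hx).ne'
  have hC : Wr X = 0 := by
    by_contra hne
    have hdiff : Tendsto (fun x => φ (x + 1) - φ x) atTop (𝓝 0) := by
      simpa using (hφ0.comp (tendsto_atTop_add_const_right atTop (1 : ℝ) tendsto_id)).sub hφ0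
    have hev : ∀ᶠ x in atTop, |φ (x + 1) - φ x| < |Wr X| := by
      have := hdiff.abs
      simp only [abs_zero] at this
      exact this.eventually (gt_mem_nhds (abs_pos.2 hne))
    obtain ⟨x, hx1, hx2⟩ := (hev.and (eventually_ge_atTop X)).exists
    obtain ⟨z, hz, e⟩ := const φ _ dφ x (x + 1) hx2 (by linarith)
    rw [e] at hx1
    have hz1 : u z ^ 2 ≤ 1 := by
      have := hXu z hz; have := hXl z hz; nlinarith
    have hz2 : 0 < u z ^ 2 := pow_pos (hXu z hz) 2
    have : |Wr X / u z ^ 2 * (x + 1 - x)| = |Wr X| / u z ^ 2 := by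
      rw [add_sub_cancel_left, mul_one, abs_div, abs_of_pos hz2]
    rw [this, div_lt_iff₀ hz2] at hx1
    nlinarith [abs_nonneg (Wr X)]
  have hφc : ∀ x, X ≤ x → φ x = φ X := by
    intro x hx
    rcases hx.eq_or_lt with rfl | h
    · rfl
    obtain ⟨z, -, e⟩ := const φ _ dφ X x le_rfl h
    rw [hC] at e
    simp at e
    linarith
  have hφX : φ X = 0 := by
    refine tendsto_nhds_unique ?_ hφ0
    refine tendsto_const_nhds.congr' ?_
    filter_upwards [eventually_ge_atTop X] with x hx using (hφc x hx).symm
  have hwX : ∀ x, X ≤ x → w x = 0 := fun x hx => by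
    have := hφc x hx
    rw [hφX] at this
    simpa [hφ, (hXu x hx).ne'] using this
  have hwX' : w' (X + 1) = 0 := by
    have h1 : w =ᶠ[𝓝 (X + 1)] fun _ => (0 : ℝ) := by
      filter_upwards [lt_mem_nhds (show X < X + 1 by linarith)] with x hx using hwX x hx.le
    have h2 := (dw (X + 1) (hX0 _ (by linarith))).congr_of_eventuallyEq h1.symm
    exact h2.unique (hasDerivAt_const _ _)
  have hw0 : ∀ x, 0 < x → w x = 0 := by
    intro x hx
    have hXp := hX0 X le_rfl
    set ε := min x X / 2 with hε
    have hε0 : 0 < ε := by positivity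
    have hcont : ContinuousOn Q (Icc ε (X + x + 2)) := by
      intro t ht
      have ht0 : t ≠ 0 := (hε0.trans_le ht.1).ne'
      apply ContinuousAt.continuousWithinAt
      simp only [hQ]
      fun_prop (disch := simp [ht0])
    obtain ⟨K, hK⟩ := isCompact_Icc.exists_bound_of_continuousOn hcont
    have := ODE_solution_unique_of_mem_Ioo (E := ℝ × ℝ) (a := ε) (b := X + x + 2)
      (t₀ := X + 1) (K := (max K 1).toNNReal) (s := fun _ => univ)
      (v := fun t p => (p.2, Q t * p.1))
      (f := fun t => (w t, w' t)) (g := fun _ => (0, 0)) ?_ ?_ ?_ ?_ ?_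
    · have := this (x := x) ⟨?_, by linarith⟩
      · exact congrArg Prod.fst this
      · have : min x X ≤ x := min_le_left _ _
        linarith
    · intro t ht
      refine (LipschitzWith.of_dist_le_mul fun p q => ?_).lipschitzOnWith
      have hKt := hK t ⟨ht.1.le, ht.2.le⟩
      rw [Real.coe_toNNReal _ (by positivity), Prod.dist_eq, Prod.dist_eq]
      simp only [Real.dist_eq]
      rw [← mul_sub, abs_mul]
      rw [Real.norm_eq_abs] at hKt
      have h1 : (1 : ℝ) ≤ max K 1 := le_max_right _ _
      have h2 : K ≤ max K 1 := le_max_left _ _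
      have h3 := le_max_left |p.1 - q.1| |p.2 - q.2|
      have h4 := le_max_right |p.1 - q.1| |p.2 - q.2|
      refine max_le ?_ ?_
      · nlinarith [abs_nonneg (p.2 - q.2)]
      · exact mul_le_mul (hKt.trans h2) h3 (abs_nonneg _) (by positivity)
    · have : min x X ≤ X := min_le_right _ _
      exact ⟨by linarith, by linarith⟩
    · intro t ht
      have ht0 := hε0.trans ht.1
      exact ⟨(dw t ht0).prodMk (dw' t ht0), mem_univ _⟩
    · intro t _
      refine ⟨?_, mem_univ _⟩
      refine (hasDerivAt_const t ((0, 0) : ℝ × ℝ)).congr_deriv ?_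
      simp only [mul_zero]
      rfl
    · simp [hwX (X + 1) (by linarith), hwX']
  funext x
  rcases le_or_gt x 0 with h | h
  · rw [hu.eq_zero x h, hv.eq_zero x h]
  · exact sub_eq_zero.1 (hw0 x h)

/-- A solution of Kummer's equation with the right behaviour at infinity gives the Whittaker
function. -/
theorem isWhittakerW_of_kummer {α ν : ℝ} {G G₁ G₂ : ℝ → ℝ}
    (h₁ : ∀ x, 0 < x → HasDerivAt G (G₁ x) x) (h₂ : ∀ x, 0 < x → HasDerivAt G₁ (G₂ x) x)
    (hode : ∀ x, 0 < x → x * G₂ x + (1 + 2 * ν - x) * G₁ x - (1 / 2 - α + ν) * G x = 0)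
    (hG : Tendsto (fun x => x ^ (1 / 2 - α + ν) * G x) atTop (𝓝 1)) :
    IsWhittakerW α ν
      (fun x => if 0 < x then Real.exp (-x / 2) * x ^ (1 / 2 + ν) * G x else 0) := by
  set u : ℝ → ℝ := fun x => if 0 < x then Real.exp (-x / 2) * x ^ (1 / 2 + ν) * G x else 0 with hu
  set E : ℝ → ℝ := fun x => Real.exp (-x / 2) * x ^ (1 / 2 + ν) with hE
  have dE : ∀ x, 0 < x → HasDerivAt E (E x * (-(1 / 2) + (1 / 2 + ν) / x)) x := by
    intro x hx
    have e1 : HasDerivAt (fun x : ℝ => Real.exp (-x / 2)) (Real.exp (-x / 2) * (-1 / 2)) x :=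
      (((hasDerivAt_id x).neg).div_const 2).exp
    have e2 := Real.hasDerivAt_rpow_const (x := x) (p := 1 / 2 + ν) (Or.inl hx.ne')
    refine (e1.mul e2).congr_deriv ?_
    simp only [hE]
    rw [Real.rpow_sub_one hx.ne']
    field_simp
  set u₁ : ℝ → ℝ := fun x => E x * ((-(1 / 2) + (1 / 2 + ν) / x) * G x + G₁ x) with hu₁
  have hd1 : ∀ x, 0 < x → HasDerivAt u (u₁ x) x := by
    intro x hx
    have e : HasDerivAt (fun x => E x * G x) (u₁ x) x := by
      refine ((dE x hx).mul (h₁ x hx)).congr_deriv ?_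
      simp only [hu₁]; ring
    refine e.congr_of_eventuallyEq ?_
    filter_upwards [lt_mem_nhds hx] with t ht
    simp [hu, hE, ht]
  have hd1' : ∀ x, 0 < x → deriv u =ᶠ[𝓝 x] u₁ := by
    intro x hx
    filter_upwards [lt_mem_nhds hx] with t ht using (hd1 t ht).deriv
  have hd2 : ∀ x, 0 < x → HasDerivAt (deriv u)
      (-(-(1 / 4) + α / x + (1 / 4 - ν ^ 2) / x ^ 2) * u x) x := by
    intro x hx
    refine HasDerivAt.congr_of_eventuallyEq ?_ (hd1' x hx)
    have e3 : HasDerivAt (fun x : ℝ => -(1 / 2) + (1 / 2 + ν) / x) (-(1 / 2 + ν) / x ^ 2) x := by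
      refine (((hasDerivAt_inv hx.ne').const_mul (1 / 2 + ν)).const_add (-(1 / 2))).congr_deriv ?_
      field_simp
    refine ((dE x hx).mul ((e3.mul (h₁ x hx)).add (h₂ x hx))).congr_deriv ?_
    have hux : u x = E x * G x := by simp [hu, hE, hx]
    have hG2 : G₂ x = ((1 / 2 - α + ν) * G x - (1 + 2 * ν - x) * G₁ x) / x := by
      rw [eq_div_iff hx.ne']
      linarith [hode x hx]
    simp only [Pi.add_apply, Pi.mul_apply]
    rw [hux, hG2]
    field_simp
    ring
  refine ⟨fun x hx => (hd1 x hx).differentiableAt, fun x hx => (hd2 x hx).differentiableAt,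
    fun x hx => ?_, ?_, fun x hx => ?_⟩
  · rw [(hd2 x hx).deriv]; ring
  · refine Asymptotics.isEquivalent_of_tendsto_one (hG.congr' ?_)
    filter_upwards [eventually_gt_atTop (0 : ℝ)] with x hx
    have hp : x ^ (1 / 2 + ν) = x ^ (1 / 2 - α + ν) * x ^ α := by
      rw [← Real.rpow_add hx]; congr 1; ring
    simp only [hu, hx, if_true, Pi.div_apply]
    rw [hp]
    have h3 := (Real.rpow_pos_of_pos hx α).ne'
    have h4 := (Real.exp_pos (-x / 2)).ne'
    rw [eq_div_iff (mul_ne_zero h3 h4)]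
    ring
  · simp [hu, not_lt.2 hx]

/-- The elementary case `W_{1/2+ν,ν}(x) = x^{1/2+ν} e^{-x/2}`. -/
theorem isWhittakerW_half_add (ν : ℝ) :
    IsWhittakerW (1 / 2 + ν) ν
      (fun x => if 0 < x then Real.exp (-x / 2) * x ^ (1 / 2 + ν) else 0) := by
  have := isWhittakerW_of_kummer (α := 1 / 2 + ν) (ν := ν) (G := fun _ => 1) (G₁ := fun _ => 0)
    (G₂ := fun _ => 0) (fun x _ => hasDerivAt_const x 1) (fun x _ => hasDerivAt_const x 0)
    (fun x _ => by ring) (by simp)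
  simpa using this

theorem one_add_rpow_le {k t : ℝ} (ht : 0 < t) :
    (1 + t) ^ k ≤ 2 ^ |k| * (1 + t ^ |k|) := by
  have h1 : (1 + t) ^ k ≤ (1 + t) ^ |k| :=
    Real.rpow_le_rpow_of_exponent_le (by linarith) (le_abs_self k)
  have h2 : (0 : ℝ) ≤ t ^ |k| := Real.rpow_nonneg ht.le _
  have h3 : (0 : ℝ) ≤ 2 ^ |k| := by positivity
  refine h1.trans ?_
  rcases le_total t 1 with h | h
  · calc (1 + t) ^ |k| ≤ 2 ^ |k| := Real.rpow_le_rpow (by linarith) (by linarith) (abs_nonneg k)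
      _ ≤ _ := by nlinarith
  · calc (1 + t) ^ |k| ≤ (2 * t) ^ |k| :=
          Real.rpow_le_rpow (by linarith) (by linarith) (abs_nonneg k)
      _ = 2 ^ |k| * t ^ |k| := Real.mul_rpow (by norm_num) ht.le
      _ ≤ _ := by nlinarith

theorem integrableOn_rpow_mul_one_add_rpow_mul_exp {p k x : ℝ} (hp : -1 < p) (hx : 0 < x) :
    IntegrableOn (fun t : ℝ => t ^ p * (1 + t) ^ k * Real.exp (-x * t)) (Ioi 0) := by
  have h0 : ∀ q : ℝ, -1 < q → IntegrableOn (fun t : ℝ => t ^ q * Real.exp (-x * t)) (Ioi 0) := by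
    intro q hq
    have := integrableOn_rpow_mul_exp_neg_mul_rpow (s := q) (p := 1) hq one_pos hx
    simpa using this
  have h1 := ((h0 p hp).add (h0 (p + |k|) (by linarith [abs_nonneg k]))).const_mul (2 ^ |k|)
  refine Integrable.mono' h1 ?_ ?_
  · exact (by fun_prop : Measurable fun t : ℝ => t ^ p * (1 + t) ^ k * Real.exp (-x * t))
      |>.aestronglyMeasurable
  · filter_upwards [ae_restrict_mem measurableSet_Ioi] with t ht
    have ht : 0 < t := ht
    rw [Real.norm_of_nonneg (by positivity)]
    simp only [Pi.add_apply]
    rw [Real.rpow_add ht]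
    have := one_add_rpow_le (k := k) ht
    have hpos : 0 < t ^ p * Real.exp (-x * t) := by positivity
    calc t ^ p * (1 + t) ^ k * Real.exp (-x * t)
        = (t ^ p * Real.exp (-x * t)) * (1 + t) ^ k := by ring
      _ ≤ (t ^ p * Real.exp (-x * t)) * (2 ^ |k| * (1 + t ^ |k|)) :=
          mul_le_mul_of_nonneg_left this hpos.le
      _ = _ := by ring

theorem hasDerivAt_integral_rpow_mul_one_add_rpow_mul_exp {p k x : ℝ} (hp : -1 < p) (hx : 0 < x) :
    HasDerivAt (fun x => ∫ t in Ioi (0 : ℝ), t ^ p * (1 + t) ^ k * Real.exp (-x * t))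
      (-∫ t in Ioi (0 : ℝ), t ^ (p + 1) * (1 + t) ^ k * Real.exp (-x * t)) x := by
  rw [← integral_neg]
  have := hasDerivAt_integral_of_dominated_loc_of_deriv_le (μ := volume.restrict (Ioi (0 : ℝ)))
    (F := fun x t => t ^ p * (1 + t) ^ k * Real.exp (-x * t))
    (F' := fun x t => -(t ^ (p + 1) * (1 + t) ^ k * Real.exp (-x * t)))
    (x₀ := x) (s := Ioi (x / 2))
    (bound := fun t => t ^ (p + 1) * (1 + t) ^ k * Real.exp (-(x / 2) * t))
    (Ioi_mem_nhds (by linarith)) ?_ ?_ ?_ ?_ ?_ ?_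
  · exact this.2
  · filter_upwards with y
    exact (by fun_prop : Measurable fun t : ℝ => t ^ p * (1 + t) ^ k * Real.exp (-y * t))
      |>.aestronglyMeasurable
  · exact integrableOn_rpow_mul_one_add_rpow_mul_exp hp hx
  · exact (by fun_prop : Measurable fun t : ℝ => -(t ^ (p + 1) * (1 + t) ^ k * Real.exp (-x * t)))
      |>.aestronglyMeasurable
  · filter_upwards [ae_restrict_mem measurableSet_Ioi] with t ht y hy
    have ht : 0 < t := ht
    have hy : x / 2 < y := hy
    rw [norm_neg, Real.norm_of_nonneg (by positivity)]
    gcongr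
  · exact integrableOn_rpow_mul_one_add_rpow_mul_exp (by linarith) (by linarith)
  · filter_upwards [ae_restrict_mem measurableSet_Ioi] with t ht y _
    have ht : 0 < t := ht
    have e : HasDerivAt (fun y : ℝ => Real.exp (-y * t)) (Real.exp (-y * t) * (-1 * t)) y :=
      ((hasDerivAt_id y).neg.mul_const t).exp
    refine (e.const_mul (t ^ p * (1 + t) ^ k)).congr_deriv ?_
    rw [Real.rpow_add_one ht.ne']
    ring

/-- The Whittaker function through its integral representation, when `α < 1/2 + ν`. -/
theorem isWhittakerW_integral {α ν : ℝ} (h : α < 1 / 2 + ν) :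
    IsWhittakerW α ν (fun x => if 0 < x then
      Real.exp (-x / 2) * x ^ (1 / 2 + ν) * ((Real.Gamma (1 / 2 - α + ν))⁻¹ *
        ∫ t in Ioi (0 : ℝ), t ^ (-(1 / 2) - α + ν) * (1 + t) ^ (-(1 / 2) + α + ν) *
          Real.exp (-x * t)) else 0) := by
  set b : ℝ := 1 / 2 - α + ν with hb
  have hb0 : 0 < b := by simp only [hb]; linarith
  have hbm : -(1 / 2) - α + ν = b - 1 := by simp only [hb]; ring
  set k : ℝ := -(1 / 2) + α + ν with hk
  have hν : 1 + 2 * ν = b + k + 1 := by simp only [hb, hk]; ring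
  rw [hbm]
  clear_value b k
  have hΓ : 0 < Real.Gamma b := Real.Gamma_pos_of_pos hb0
  set J : ℝ → ℝ → ℝ := fun p x =>
    ∫ t in Ioi (0 : ℝ), t ^ p * (1 + t) ^ k * Real.exp (-x * t) with hJ
  have dJ : ∀ p x : ℝ, -1 < p → 0 < x → HasDerivAt (J p) (-J (p + 1) x) x :=
    fun p x hp hx => hasDerivAt_integral_rpow_mul_one_add_rpow_mul_exp hp hx
  have iJ : ∀ p x : ℝ, -1 < p → 0 < x →
      IntegrableOn (fun t : ℝ => t ^ p * (1 + t) ^ k * Real.exp (-x * t)) (Ioi 0) :=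
    fun p x hp hx => integrableOn_rpow_mul_one_add_rpow_mul_exp hp hx
  refine isWhittakerW_of_kummer (G := fun x => (Real.Gamma b)⁻¹ * J (b - 1) x)
    (G₁ := fun x => (Real.Gamma b)⁻¹ * -J b x) (G₂ := fun x => (Real.Gamma b)⁻¹ * J (b + 1) x)
    (fun x hx => ?_) (fun x hx => ?_) (fun x hx => ?_) ?_
  · have := dJ (b - 1) x (by linarith) hx
    rw [sub_add_cancel] at this
    exact this.const_mul _
  · have := (dJ b x (by linarith) hx).neg
    rw [neg_neg] at this
    exact this.const_mul _
  · have key : b * J (b - 1) x + (b + k + 1) * J b x - x * J b x - x * J (b + 1) x = 0 := by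
      have i1 := (iJ (b - 1) x (by linarith) hx).const_mul b
      have i2 := (iJ b x (by linarith) hx).const_mul (b + k + 1)
      have i3 := (iJ b x (by linarith) hx).const_mul x
      have i4 := (iJ (b + 1) x (by linarith) hx).const_mul x
      have hint := ((i1.add i2).sub i3).sub i4
      have hval := integral_Ioi_of_hasDerivAt_of_tendsto (a := (0 : ℝ)) (m := 0)
        (f := fun t : ℝ => t ^ b * (1 + t) ^ (k + 1) * Real.exp (-x * t)) ?_ ?_ hint ?_
      · have e1 := integral_sub ((i1.add i2).sub i3) i4
        have e2 := integral_sub (i1.add i2) i3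
        have e3 := integral_add i1 i2
        simp only [Pi.add_apply, Pi.sub_apply] at e1 e2 e3 hval
        rw [e1, e2, e3, integral_const_mul, integral_const_mul, integral_const_mul,
          integral_const_mul] at hval
        simp only [hJ]
        rw [hval]
        simp [Real.zero_rpow hb0.ne']
      · apply ContinuousAt.continuousWithinAt
        have c1 : ContinuousAt (fun t : ℝ => t ^ b) 0 :=
          Real.continuousAt_rpow_const _ _ (Or.inr hb0.le)
        have c2 : ContinuousAt (fun t : ℝ => (1 + t) ^ (k + 1)) 0 :=
          (by fun_prop : ContinuousAt (fun t : ℝ => 1 + t) 0).rpow_const (Or.inl (by norm_num))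
        exact (c1.mul c2).mul (by fun_prop)
      · intro t ht
        have ht : 0 < t := ht
        have ht1 : 0 < 1 + t := by linarith
        have e1 := Real.hasDerivAt_rpow_const (x := t) (p := b) (Or.inl ht.ne')
        have e2 := ((hasDerivAt_id t).const_add 1).rpow_const (p := k + 1) (Or.inl ht1.ne')
        have e3 : HasDerivAt (fun t : ℝ => Real.exp (-x * t)) (Real.exp (-x * t) * (-x * 1)) t :=
          ((hasDerivAt_id t).const_mul (-x)).exp
        refine ((e1.mul e2).mul e3).congr_deriv ?_
        have r1 : t ^ b = t ^ (b - 1) * t := by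
          rw [← Real.rpow_add_one ht.ne']; ring_nf
        simp only [Pi.add_apply, Pi.sub_apply, id, Pi.mul_apply]
        rw [Real.rpow_add_one ht.ne', add_sub_cancel_right, r1, Real.rpow_add_one ht1.ne']
        ring
      · have i5 : Tendsto (fun t : ℝ => 2 ^ |k + 1| * (t ^ b * Real.exp (-x * t) +
            t ^ (b + |k + 1|) * Real.exp (-x * t))) atTop (𝓝 0) := by
          simpa using ((tendsto_rpow_mul_exp_neg_mul_atTop_nhds_zero b x hx).add
            (tendsto_rpow_mul_exp_neg_mul_atTop_nhds_zero (b + |k + 1|) x hx)).const_mul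
              (2 ^ |k + 1|)
        refine squeeze_zero' ?_ ?_ i5
        · filter_upwards [eventually_gt_atTop (0 : ℝ)] with t ht
          positivity
        · filter_upwards [eventually_gt_atTop (0 : ℝ)] with t ht
          have := one_add_rpow_le (k := k + 1) ht
          have hpos : 0 < t ^ b * Real.exp (-x * t) := by positivity
          rw [Real.rpow_add ht]
          calc t ^ b * (1 + t) ^ (k + 1) * Real.exp (-x * t)
              = (t ^ b * Real.exp (-x * t)) * (1 + t) ^ (k + 1) := by ring
            _ ≤ (t ^ b * Real.exp (-x * t)) * (2 ^ |k + 1| * (1 + t ^ |k + 1|)) :=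
                mul_le_mul_of_nonneg_left this hpos.le
            _ = _ := by ring
    rw [hν, ← hb]
    linear_combination -(Real.Gamma b)⁻¹ * key
  · have hlim : Tendsto (fun x : ℝ => ∫ s in Ioi (0 : ℝ),
        s ^ (b - 1) * (1 + s / x) ^ k * Real.exp (-s)) atTop
        (𝓝 (∫ s in Ioi (0 : ℝ), s ^ (b - 1) * Real.exp (-s))) := by
      have h0 : ∀ q : ℝ, -1 < q → IntegrableOn (fun t : ℝ => t ^ q * Real.exp (-t)) (Ioi 0) := by
        intro q hq
        have := integrableOn_rpow_mul_exp_neg_rpow (s := q) (p := 1) hq one_pos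
        simpa using this
      refine tendsto_integral_filter_of_dominated_convergence
        (fun s => 2 ^ |k| * (s ^ (b - 1) * Real.exp (-s) + s ^ (b - 1 + |k|) * Real.exp (-s)))
        ?_ ?_ ?_ ?_
      · filter_upwards with x
        exact (by fun_prop : Measurable fun s : ℝ => s ^ (b - 1) * (1 + s / x) ^ k * Real.exp (-s))
          |>.aestronglyMeasurable
      · filter_upwards [eventually_ge_atTop (1 : ℝ)] with x hx
        filter_upwards [ae_restrict_mem measurableSet_Ioi] with s hs
        have hs : 0 < s := hs
        have hx0 : 0 < x := by linarith
        rw [Real.norm_of_nonneg (by positivity), Real.rpow_add hs]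
        have h1 := one_add_rpow_le (k := k) (div_pos hs hx0)
        have h2 : (s / x) ^ |k| ≤ s ^ |k| :=
          Real.rpow_le_rpow (by positivity) (div_le_self hs.le hx) (abs_nonneg k)
        have h3 : (0 : ℝ) < 2 ^ |k| := by positivity
        have hpos : 0 < s ^ (b - 1) * Real.exp (-s) := by positivity
        calc s ^ (b - 1) * (1 + s / x) ^ k * Real.exp (-s)
            = (s ^ (b - 1) * Real.exp (-s)) * (1 + s / x) ^ k := by ring
          _ ≤ (s ^ (b - 1) * Real.exp (-s)) * (2 ^ |k| * (1 + s ^ |k|)) := by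
              refine mul_le_mul_of_nonneg_left (h1.trans ?_) hpos.le
              gcongr
          _ = _ := by ring
      · exact ((h0 (b - 1) (by linarith)).add
          (h0 (b - 1 + |k|) (by linarith [abs_nonneg k]))).const_mul _
      · filter_upwards [ae_restrict_mem measurableSet_Ioi] with s hs
        have c1 : Tendsto (fun x : ℝ => 1 + s / x) atTop (𝓝 (1 + 0)) :=
          (tendsto_const_nhds.div_atTop tendsto_id).const_add 1
        have c2 := (c1.rpow_const (p := k) (Or.inl (by norm_num))).const_mul (s ^ (b - 1))
        simpa using c2.mul_const (Real.exp (-s))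
    have hΓe : ∫ s in Ioi (0 : ℝ), s ^ (b - 1) * Real.exp (-s) = Real.Gamma b := by
      rw [Real.Gamma_eq_integral hb0]
      simp only [mul_comm]
    rw [hΓe] at hlim
    have := hlim.const_mul (Real.Gamma b)⁻¹
    rw [inv_mul_cancel₀ hΓ.ne'] at this
    refine this.congr' ?_
    filter_upwards [eventually_gt_atTop (0 : ℝ)] with x hx
    have hsub := integral_comp_mul_left_Ioi
      (fun s : ℝ => s ^ (b - 1) * (1 + s / x) ^ k * Real.exp (-s)) 0 hx
    simp only [mul_zero, smul_eq_mul] at hsub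
    have hJx : J (b - 1) x = x ^ (-(b - 1)) * (x⁻¹ *
        ∫ s in Ioi (0 : ℝ), s ^ (b - 1) * (1 + s / x) ^ k * Real.exp (-s)) := by
      rw [← hsub, ← integral_const_mul]
      refine setIntegral_congr_fun measurableSet_Ioi fun t ht => ?_
      have ht : 0 < t := ht
      rw [Real.mul_rpow hx.le ht.le, mul_div_cancel_left₀ _ hx.ne', Real.rpow_neg hx.le]
      have := (Real.rpow_pos_of_pos hx (b - 1)).ne'
      field_simp
    have hxb : x ^ b * x ^ (-(b - 1)) * x⁻¹ = 1 := by
      rw [← Real.rpow_neg_one x, ← Real.rpow_add hx, ← Real.rpow_add hx,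
        show b + -(b - 1) + -1 = 0 by ring, Real.rpow_zero]
    rw [hJx, ← hb]
    linear_combination -(Real.Gamma b)⁻¹ * (∫ s in Ioi (0 : ℝ),
      s ^ (b - 1) * (1 + s / x) ^ k * Real.exp (-s)) * hxb

/-- Existence of the Whittaker function `W_{α,ν}` for `α ≤ 1/2 + ν`. -/
theorem isWhittakerW_whittakerW {α ν : ℝ} (h : α ≤ 1 / 2 + ν) :
    IsWhittakerW α ν (whittakerW α ν) := by
  refine Classical.epsilon_spec (p := IsWhittakerW α ν) ?_
  rcases h.lt_or_eq with h | rfl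
  · exact ⟨_, isWhittakerW_integral h⟩
  · exact ⟨_, isWhittakerW_half_add ν⟩

/-- The parabolic cylinder function `D_μ(z)`, for real `μ` and `z > 0`. -/
noncomputable def parabolicCylinderD (μ z : ℝ) : ℝ :=
  2 ^ (μ / 2 + 1 / 4) * z ^ (-(1 / 2) : ℝ) * whittakerW (μ / 2 + 1 / 4) (1 / 4) (z ^ 2 / 2)

/-- The weight `m_a(ξ) = ξ^{-2a-1} e^{-ξ}`. -/
noncomputable def whittakerWeight (a ξ : ℝ) : ℝ :=
  ξ ^ (-2 * a - 1) * Real.exp (-ξ)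

/-- The measure `m_a(ξ) dξ` on `(0, ∞)`; the space `L_p^a` is `L_p` of this measure. -/
noncomputable def whittakerMeasure (a : ℝ) : Measure ℝ :=
  (volume.restrict (Ioi 0)).withDensity (fun ξ => ENNReal.ofReal (whittakerWeight a ξ))

/-- The kernel `q_a(x, y, ξ)` of the product formula. -/
noncomputable def whittakerKernel (a x y ξ : ℝ) : ℝ :=
  2 ^ (-(3 / 2) + a) * Real.pi ^ (-(1 / 2) : ℝ) * (x * y * ξ) ^ a *
    Real.exp (x + y + ξ - (x * y + x * ξ + y * ξ) ^ 2 / (8 * x * y * ξ)) *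
    parabolicCylinderD (1 - 2 * a) ((x * y + x * ξ + y * ξ) / (2 * x * y * ξ) ^ (1 / 2 : ℝ))

/-- The double integral defining the convolution of `f` and `g` exists (as a Lebesgue integral)
at almost every point `x` of `(0, ∞)`. -/
def WhittakerConvExists (a : ℝ) (f g : ℝ → ℂ) : Prop :=
  ∀ᵐ x ∂(volume.restrict (Ioi (0 : ℝ))),
    Integrable (fun z : ℝ × ℝ => (whittakerKernel a x z.1 z.2 : ℂ) * f z.1 * g z.2)
      ((whittakerMeasure a).prod (whittakerMeasure a))

/-- The index Whittaker convolution
`(f ∗_a g)(x) = ∫₀^∞ ∫₀^∞ q_a(x,y,ξ) f(y) g(ξ) m_a(y) dy m_a(ξ) dξ`. -/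
noncomputable def whittakerConv (a : ℝ) (f g : ℝ → ℂ) (x : ℝ) : ℂ :=
  ∫ ξ, ∫ y, (whittakerKernel a x y ξ : ℂ) * f y * g ξ ∂(whittakerMeasure a) ∂(whittakerMeasure a)

/-! The inequality uses only that the kernel is nonnegative and has three marginals bounded by 1:
with any two variables fixed, its integral over the third is at most 1. Write `1/r = 1/p₁ + 1/p₂ -
1`. For finite `p₁`, `p₂`, Hölder with weights `1/r`, `1/p₁ - 1/r`, `1/p₂ - 1/r` is applied to `k
F^p₁ G^p₂`, `k F^p₁`, `k G^p₂`. Two marginals bound the last two factors by powers of the norms of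
`F` and `G`; the third marginal bounds the first factor once it is integrated in `x`. This is
`lintegral_young_pointwise` and `eLpNorm_lintegral_kernel_le`.

Since `q_a` is symmetric in its three variables, one bound gives all three marginals: `∫ q_a(x,y,ξ)
m_a(ξ) dξ ≤ 1`, which is `lintegral_whittakerKernel_le`. For `a = 0` the function `D_1` is
elementary and the integral is a Gaussian in disguise. For `a > 0`, the integral representation of
`D_{1-2a}` writes `q_a m_a` as an integral over `s` of `e^{-s}` against a truncated power `(s -
c(ξ))₊^{a-1}`. After Tonelli, a substitution in `ξ` completes the square and replaces `c(ξ)` by `x +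
y + v²`; the `s`-integral is then a Gamma integral and the `v`-integral a Gaussian, and the
constants cancel. -/

/-! ### Young's inequality for kernels with bounded marginals -/

section Young

variable {X Y Z : Type*} [MeasurableSpace X] [MeasurableSpace Y] [MeasurableSpace Z]

/-- Here `s` plays the role of `1/r`. The exponents `s`, `p⁻¹ - s`, `q⁻¹ - s` sum to one, and `k`,
`F`, `G` are each recovered by collecting their powers from the three Hölder factors. The value `s =
0` is allowed and serves `r = ∞`. -/
theorem lintegral_young_pointwise (μ : Measure Y) (ν : Measure Z)
    [SFinite μ] [SFinite ν] {k : Y → Z → ℝ≥0∞} (hk : Measurable (Function.uncurry k))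
    (h₁ : ∀ᵐ y ∂μ, ∫⁻ z, k y z ∂ν ≤ 1) (h₂ : ∀ᵐ z ∂ν, ∫⁻ y, k y z ∂μ ≤ 1)
    {F : Y → ℝ≥0∞} {G : Z → ℝ≥0∞} (hF : Measurable F) (hG : Measurable G)
    {p q s : ℝ} (hp : 1 ≤ p) (hq : 1 ≤ q) (hs : 0 ≤ s) (hpq : s = p⁻¹ + q⁻¹ - 1) :
    ∫⁻ w, k w.1 w.2 * F w.1 * G w.2 ∂(μ.prod ν) ≤
      (∫⁻ w, k w.1 w.2 * F w.1 ^ p * G w.2 ^ q ∂(μ.prod ν)) ^ s *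
        (∫⁻ y, F y ^ p ∂μ) ^ (p⁻¹ - s) * (∫⁻ z, G z ^ q ∂ν) ^ (q⁻¹ - s) := by
  have hp0 : 0 < p := by linarith
  have hq0 : 0 < q := by linarith
  have hp' : p⁻¹ ≤ 1 := inv_le_one_of_one_le₀ hp
  have hq' : q⁻¹ ≤ 1 := inv_le_one_of_one_le₀ hq
  have ep : 0 ≤ p⁻¹ - s := by linarith
  have eq : 0 ≤ q⁻¹ - s := by linarith
  have hk' : Measurable fun w : Y × Z => k w.1 w.2 := hk
  have hFp : Measurable fun w : Y × Z => F w.1 ^ p := (hF.comp measurable_fst).pow_const p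
  have hGq : Measurable fun w : Y × Z => G w.2 ^ q := (hG.comp measurable_snd).pow_const q
  have iF : ∫⁻ w, k w.1 w.2 * F w.1 ^ p ∂(μ.prod ν) ≤ ∫⁻ y, F y ^ p ∂μ := by
    rw [lintegral_prod _ (hk'.fun_mul hFp).aemeasurable]
    refine lintegral_mono_ae ?_
    filter_upwards [h₁] with y hy
    rw [lintegral_mul_const _ (hk.of_uncurry_left)]
    exact mul_le_of_le_one_left' hy
  have iG : ∫⁻ w, k w.1 w.2 * G w.2 ^ q ∂(μ.prod ν) ≤ ∫⁻ z, G z ^ q ∂ν := by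
    rw [lintegral_prod_symm _ (hk'.fun_mul hGq).aemeasurable]
    refine lintegral_mono_ae ?_
    filter_upwards [h₂] with z hz
    rw [lintegral_mul_const _ (hk.of_uncurry_right)]
    exact mul_le_of_le_one_left' hz
  have holder := ENNReal.lintegral_prod_norm_pow_le (μ := μ.prod ν) (Finset.univ : Finset (Fin 3))
    (f := ![fun w => k w.1 w.2 * F w.1 ^ p * G w.2 ^ q, fun w => k w.1 w.2 * F w.1 ^ p,
      fun w => k w.1 w.2 * G w.2 ^ q]) (p := ![s, p⁻¹ - s, q⁻¹ - s])
    (by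
      intro i _
      fin_cases i
      · exact ((hk'.mul hFp).mul hGq).aemeasurable
      · exact (hk'.fun_mul hFp).aemeasurable
      · exact (hk'.fun_mul hGq).aemeasurable)
    (by simp [Fin.sum_univ_three]; linarith)
    (by intro i _; fin_cases i <;> [exact hs; exact ep; exact eq])
  simp only [Fin.prod_univ_three, Matrix.cons_val_zero, Matrix.cons_val_one, Matrix.cons_val] at holder
  refine le_trans (le_of_eq ?_) (holder.trans ?_)
  · refine lintegral_congr fun w => ?_
    -- All exponents are nonnegative, so the power laws hold in `ℝ≥0∞` even at the values 0 and ∞.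
    have split : ∀ (e : ℝ) (_ : 0 < e) (_ : 0 ≤ e⁻¹ - s) (u : ℝ≥0∞),
        (u ^ e) ^ s * (u ^ e) ^ (e⁻¹ - s) = u := by
      intro e he hes u
      rw [← ENNReal.rpow_add_of_nonneg _ _ hs hes, ← ENNReal.rpow_mul, add_sub_cancel,
        mul_inv_cancel₀ he.ne', ENNReal.rpow_one]
    have splitk : k w.1 w.2 ^ s * k w.1 w.2 ^ (p⁻¹ - s) * k w.1 w.2 ^ (q⁻¹ - s) = k w.1 w.2 := by
      rw [← ENNReal.rpow_add_of_nonneg _ _ hs ep, ← ENNReal.rpow_add_of_nonneg _ _ (by linarith) eq,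
        show s + (p⁻¹ - s) + (q⁻¹ - s) = 1 by linarith, ENNReal.rpow_one]
    simp only [ENNReal.mul_rpow_of_nonneg _ _ hs, ENNReal.mul_rpow_of_nonneg _ _ ep,
      ENNReal.mul_rpow_of_nonneg _ _ eq]
    calc k w.1 w.2 * F w.1 * G w.2
        = (k w.1 w.2 ^ s * k w.1 w.2 ^ (p⁻¹ - s) * k w.1 w.2 ^ (q⁻¹ - s)) *
          ((F w.1 ^ p) ^ s * (F w.1 ^ p) ^ (p⁻¹ - s)) *
          ((G w.2 ^ q) ^ s * (G w.2 ^ q) ^ (q⁻¹ - s)) := by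
          rw [splitk, split p hp0 ep, split q hq0 eq]
      _ = _ := by ring
  · gcongr

/-- Young's inequality for a kernel all of whose marginals are at most one. -/
theorem eLpNorm_lintegral_kernel_le (κ : Measure X) (μ : Measure Y) (ν : Measure Z)
    [SFinite κ] [SFinite μ] [SFinite ν] {k : X → Y → Z → ℝ≥0∞}
    (hk : Measurable fun w : X × Y × Z => k w.1 w.2.1 w.2.2)
    (h₁ : ∀ᵐ x ∂κ, ∀ᵐ y ∂μ, ∫⁻ z, k x y z ∂ν ≤ 1)
    (h₂ : ∀ᵐ x ∂κ, ∀ᵐ z ∂ν, ∫⁻ y, k x y z ∂μ ≤ 1)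
    (h₃ : ∀ᵐ y ∂μ, ∀ᵐ z ∂ν, ∫⁻ x, k x y z ∂κ ≤ 1)
    {F : Y → ℝ≥0∞} {G : Z → ℝ≥0∞} (hF : Measurable F) (hG : Measurable G)
    {p q r : ℝ≥0∞} (hp : 1 ≤ p) (hq : 1 ≤ q) (hpq : 1 ≤ 1 / p + 1 / q)
    (hr : 1 / r = 1 / p + 1 / q - 1) :
    eLpNorm (fun x => ∫⁻ w, k x w.1 w.2 * F w.1 * G w.2 ∂(μ.prod ν)) r κ ≤
      eLpNorm F p μ * eLpNorm G q ν := by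
  have hkx : ∀ x, Measurable (Function.uncurry (k x)) := fun x =>
    hk.comp (measurable_const.prodMk measurable_id)
  have hkw : ∀ x, Measurable fun w : Y × Z => k x w.1 w.2 := hkx
  have hFw : Measurable fun w : Y × Z => F w.1 := hF.comp measurable_fst
  have hGw : Measurable fun w : Y × Z => G w.2 := hG.comp measurable_snd
  have sup_le : ∀ C : ℝ≥0∞, r = ∞ →
      (∀ᵐ x ∂κ, ∫⁻ w, k x w.1 w.2 * F w.1 * G w.2 ∂(μ.prod ν) ≤ C) →
      eLpNorm (fun x => ∫⁻ w, k x w.1 w.2 * F w.1 * G w.2 ∂(μ.prod ν)) r κ ≤ C := by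
    rintro C rfl h
    rw [eLpNorm_exponent_top]
    exact eLpNormEssSup_le_of_ae_enorm_bound h
  have eq_one : ∀ t : ℝ≥0∞, 1 ≤ t → 1 ≤ 1 / t → t = 1 := fun t h h' =>
    le_antisymm (by rw [one_div, ENNReal.one_le_inv] at h'; exact h') h
  -- If one of the exponents is infinite, `hpq` forces the other to be 1, and then `r = ∞`: the
  -- kernel averages the bounded function, and one marginal suffices.
  rcases eq_or_ne p ∞ with rfl | hpt
  · have hq1 : q = 1 := eq_one q hq (by simpa using hpq)
    subst hq1
    refine sup_le _ (by simpa using hr) ?_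
    filter_upwards [h₂] with x hx
    rw [eLpNorm_exponent_top, eLpNorm_one_eq_lintegral_enorm,
      lintegral_prod_symm _ (((hkw x).fun_mul hFw).fun_mul hGw).aemeasurable]
    simp only [enorm_eq_self]
    rw [← lintegral_const_mul _ hG]
    refine lintegral_mono_ae ?_
    filter_upwards [hx] with z hz
    rw [lintegral_mul_const _ ((hkx x).of_uncurry_right.fun_mul hF)]
    refine mul_le_mul_left ?_ _
    calc ∫⁻ y, k x y z * F y ∂μ ≤ ∫⁻ y, k x y z * eLpNormEssSup F μ ∂μ := by
          refine lintegral_mono_ae ?_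
          filter_upwards [enorm_ae_le_eLpNormEssSup F μ] with y hy
          exact mul_le_mul_right hy _
      _ ≤ eLpNormEssSup F μ := by
          rw [lintegral_mul_const _ (hkx x).of_uncurry_right]
          exact mul_le_of_le_one_left' hz
  rcases eq_or_ne q ∞ with rfl | hqt
  · have hp1 : p = 1 := eq_one p hp (by simpa using hpq)
    subst hp1
    refine sup_le _ (by simpa using hr) ?_
    filter_upwards [h₁] with x hx
    rw [eLpNorm_exponent_top, eLpNorm_one_eq_lintegral_enorm,
      lintegral_prod _ (((hkw x).fun_mul hFw).fun_mul hGw).aemeasurable]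
    simp only [enorm_eq_self]
    rw [← lintegral_mul_const _ hF]
    refine lintegral_mono_ae ?_
    filter_upwards [hx] with y hy
    calc ∫⁻ z, k x y z * F y * G z ∂ν ≤ ∫⁻ z, k x y z * (F y * eLpNormEssSup G ν) ∂ν := by
          refine lintegral_mono_ae ?_
          filter_upwards [enorm_ae_le_eLpNormEssSup G ν] with z hz
          rw [mul_assoc]
          gcongr
          exact hz
      _ ≤ F y * eLpNormEssSup G ν := by
          rw [lintegral_mul_const _ (hkx x).of_uncurry_left]
          exact mul_le_of_le_one_left' hy
  have hp0 : p ≠ 0 := (one_pos.trans_le hp).ne'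
  have hq0 : q ≠ 0 := (one_pos.trans_le hq).ne'
  obtain ⟨P, rfl⟩ : ∃ P : NNReal, p = P := ⟨p.toNNReal, (ENNReal.coe_toNNReal hpt).symm⟩
  obtain ⟨Q, rfl⟩ : ∃ Q : NNReal, q = Q := ⟨q.toNNReal, (ENNReal.coe_toNNReal hqt).symm⟩
  have hP : (1 : ℝ) ≤ P := by exact_mod_cast hp
  have hQ : (1 : ℝ) ≤ Q := by exact_mod_cast hq
  have hP0 : P ≠ 0 := by simpa using hp0
  have hQ0 : Q ≠ 0 := by simpa using hq0
  have hsum : (1 : ℝ≥0∞) / P + 1 / Q = ((P⁻¹ + Q⁻¹ : NNReal) : ℝ≥0∞) := by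
    simp [ENNReal.coe_inv hP0, ENNReal.coe_inv hQ0]
  rw [hsum] at hr hpq
  have hpq' : 1 ≤ P⁻¹ + Q⁻¹ := by exact_mod_cast hpq
  -- This is `1/r`; by `hpq'` the truncated subtraction is a genuine one.
  obtain ⟨s, hs⟩ : ∃ s : NNReal, s = P⁻¹ + Q⁻¹ - 1 := ⟨_, rfl⟩
  have hsR : (s : ℝ) = (P : ℝ)⁻¹ + (Q : ℝ)⁻¹ - 1 := by
    rw [hs, NNReal.coe_sub hpq']; simp
  have hrs : r = (s : ℝ≥0∞)⁻¹ := by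
    rw [← inv_inv r, ← one_div r, hr, hs]; simp
  set A := ∫⁻ y, F y ^ (P : ℝ) ∂μ with hA
  set B := ∫⁻ z, G z ^ (Q : ℝ) ∂ν with hB
  set H : X → ℝ≥0∞ := fun x => ∫⁻ w, k x w.1 w.2 * F w.1 ^ (P : ℝ) * G w.2 ^ (Q : ℝ) ∂(μ.prod ν)
    with hH
  have nF : eLpNorm F P μ = A ^ (P : ℝ)⁻¹ := by
    rw [eLpNorm_eq_lintegral_rpow_enorm_toReal hp0 hpt]; simp [hA]
  have nG : eLpNorm G Q ν = B ^ (Q : ℝ)⁻¹ := by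
    rw [eLpNorm_eq_lintegral_rpow_enorm_toReal hq0 hqt]; simp [hB]
  have hpt' : ∀ᵐ x ∂κ, ∫⁻ w, k x w.1 w.2 * F w.1 * G w.2 ∂(μ.prod ν) ≤
      H x ^ (s : ℝ) * A ^ ((P : ℝ)⁻¹ - s) * B ^ ((Q : ℝ)⁻¹ - s) := by
    filter_upwards [h₁, h₂] with x hx1 hx2
    exact lintegral_young_pointwise μ ν (hkx x) hx1 hx2 hF hG hP hQ s.2 hsR
  rw [nF, nG]
  rcases eq_or_ne s 0 with h0 | h0
  -- For `r = ∞` the factor `H x ^ s` is 1, so the pointwise bound is already uniform in `x`.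
  · refine sup_le _ (by simp [hrs, h0]) ?_
    simpa [h0] using hpt'
  have hs0 : (0 : ℝ) < s := by positivity
  have hrr : r = ((s⁻¹ : NNReal) : ℝ≥0∞) := by rw [hrs, ENNReal.coe_inv h0]
  have hHm : Measurable fun w : X × Y × Z =>
      k w.1 w.2.1 w.2.2 * F w.2.1 ^ (P : ℝ) * G w.2.2 ^ (Q : ℝ) :=
    (hk.mul ((hFw.comp measurable_snd).pow_const _)).mul ((hGw.comp measurable_snd).pow_const _)
  -- Tonelli makes `x` the innermost variable, where the third marginal applies.
  have hHi : ∫⁻ x, H x ∂κ ≤ A * B := by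
    have hswap := lintegral_lintegral_swap (μ := κ) (ν := μ.prod ν) (f := fun x w =>
      k x w.1 w.2 * F w.1 ^ (P : ℝ) * G w.2 ^ (Q : ℝ)) hHm.aemeasurable
    simp only [hH]
    rw [hswap, lintegral_prod _ hHm.lintegral_prod_left'.aemeasurable,
      ← lintegral_mul_const _ (hF.pow_const _)]
    refine lintegral_mono_ae ?_
    filter_upwards [h₃] with y hy
    rw [← lintegral_const_mul _ (hG.pow_const _)]
    refine lintegral_mono_ae ?_
    filter_upwards [hy] with z hz
    have : Measurable fun x => k x y z := hk.comp (measurable_id.prodMk (measurable_const (a := (y, z))))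
    rw [lintegral_mul_const _ (this.mul_const _), lintegral_mul_const _ this, mul_assoc]
    exact mul_le_of_le_one_left' hz
  have ep : 0 ≤ (P : ℝ)⁻¹ - s := by
    have := inv_le_one_of_one_le₀ hQ; linarith
  have eq : 0 ≤ (Q : ℝ)⁻¹ - s := by
    have := inv_le_one_of_one_le₀ hP; linarith
  rw [hrr, eLpNorm_eq_lintegral_rpow_enorm_toReal (by simpa using h0) ENNReal.coe_ne_top]
  simp only [ENNReal.coe_toReal, NNReal.coe_inv, enorm_eq_self, one_div, inv_inv]
  calc (∫⁻ x, (∫⁻ w, k x w.1 w.2 * F w.1 * G w.2 ∂(μ.prod ν)) ^ (s : ℝ)⁻¹ ∂κ) ^ (s : ℝ)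
      ≤ (∫⁻ x, H x * (A ^ ((P : ℝ)⁻¹ - s) * B ^ ((Q : ℝ)⁻¹ - s)) ^ (s : ℝ)⁻¹ ∂κ) ^ (s : ℝ) := by
        refine ENNReal.rpow_le_rpow (lintegral_mono_ae ?_) hs0.le
        filter_upwards [hpt'] with x hx
        refine (ENNReal.rpow_le_rpow hx (inv_nonneg.2 hs0.le)).trans_eq ?_
        rw [mul_assoc, ENNReal.mul_rpow_of_nonneg _ _ (inv_nonneg.2 hs0.le),
          ENNReal.rpow_rpow_inv hs0.ne']
    _ ≤ (A * B * (A ^ ((P : ℝ)⁻¹ - s) * B ^ ((Q : ℝ)⁻¹ - s)) ^ (s : ℝ)⁻¹) ^ (s : ℝ) := by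
        rw [lintegral_mul_const _ hHm.lintegral_prod_right']
        gcongr
    _ = (A ^ (s : ℝ) * A ^ ((P : ℝ)⁻¹ - s)) * (B ^ (s : ℝ) * B ^ ((Q : ℝ)⁻¹ - s)) := by
        rw [ENNReal.mul_rpow_of_nonneg _ _ hs0.le, ENNReal.mul_rpow_of_nonneg _ _ hs0.le,
          ENNReal.rpow_inv_rpow hs0.ne']
        ring
    _ = A ^ (P : ℝ)⁻¹ * B ^ (Q : ℝ)⁻¹ := by
        rw [← ENNReal.rpow_add_of_nonneg _ _ hs0.le ep, ← ENNReal.rpow_add_of_nonneg _ _ hs0.le eq]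
        simp

end Young

/-! ### Substitution and Gaussian integrals -/

/-- Only upper bounds are needed, so the exact image of a substitution never has to be determined:
injectivity is enough. -/
theorem setLIntegral_abs_deriv_mul_comp_le {s t : Set ℝ} (hs : MeasurableSet s)
    {v v' : ℝ → ℝ} (hv : ∀ x ∈ s, HasDerivAt v (v' x) x) (hinj : InjOn v s)
    (hst : MapsTo v s t) (g : ℝ → ℝ≥0∞) :
    ∫⁻ x in s, ENNReal.ofReal |v' x| * g (v x) ≤ ∫⁻ y in t, g y := by
  rw [← lintegral_image_eq_lintegral_abs_deriv_mul hs
    (fun x hx => (hv x hx).hasDerivWithinAt) hinj g]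
  exact lintegral_mono_set hst.image_subset

theorem lintegral_exp_neg_mul_sq {b : ℝ} (hb : 0 < b) :
    ∫⁻ v : ℝ, ENNReal.ofReal (Real.exp (-b * v ^ 2)) = ENNReal.ofReal √(Real.pi / b) := by
  rw [← ofReal_integral_eq_lintegral_ofReal (integrable_exp_neg_mul_sq hb)
    (ae_of_all _ fun _ => (Real.exp_pos _).le), integral_gaussian]

/-! ### Explicit forms of the parabolic cylinder function -/

/-- The Whittaker parameters are `(3/4, 1/4)`, the elementary borderline `α = 1/2 + ν`. As
`whittakerW` is obtained by choice, the formula is transferred by uniqueness. -/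
theorem parabolicCylinderD_one {z : ℝ} (hz : 0 < z) :
    parabolicCylinderD 1 z = z * Real.exp (-z ^ 2 / 4) := by
  rw [parabolicCylinderD, (isWhittakerW_whittakerW le_rfl).unique (isWhittakerW_half_add (1 / 4))]
  beta_reduce
  rw [if_pos (by positivity), show z ^ 2 / 2 = z ^ (2 : ℝ) * 2⁻¹ by norm_num [div_eq_mul_inv],
    Real.mul_rpow (by positivity) (by positivity), ← Real.rpow_mul hz.le,
    Real.inv_rpow (by norm_num)]
  have h2 : (2 : ℝ) ^ (1 / 2 + 1 / 4 : ℝ) ≠ 0 := by positivity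
  have h3 : z ^ (-(1 / 2) : ℝ) * z ^ (2 * (1 / 2 + 1 / 4) : ℝ) = z := by
    rw [← Real.rpow_add hz]; norm_num
  have h4 : -(z ^ (2 : ℝ) * 2⁻¹) / 2 = -z ^ 2 / 4 := by norm_num; ring
  rw [h4]
  calc _ = (2 ^ (1 / 2 + 1 / 4 : ℝ) * (2 ^ (1 / 2 + 1 / 4 : ℝ))⁻¹) *
        (z ^ (-(1 / 2) : ℝ) * z ^ (2 * (1 / 2 + 1 / 4) : ℝ)) * Real.exp (-z ^ 2 / 4) := by ring
    _ = _ := by rw [h3, mul_inv_cancel₀ h2, one_mul]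

/-- Here `α = 3/4 - a` lies strictly below `1/2 + ν = 3/4`, so the Laplace-type representation is
available. -/
theorem parabolicCylinderD_eq_integral {a z : ℝ} (ha : 0 < a) (hz : 0 < z) :
    parabolicCylinderD (1 - 2 * a) z = 2 ^ (-a) * z * Real.exp (-z ^ 2 / 4) * (Real.Gamma a)⁻¹ *
      ∫ t in Ioi (0 : ℝ), t ^ (a - 1) * (1 + t) ^ (1 / 2 - a) * Real.exp (-(z ^ 2 / 2) * t) := by
  have hα : (1 - 2 * a) / 2 + 1 / 4 = 3 / 4 - a := by ring
  have hlt : 3 / 4 - a < 1 / 2 + 1 / 4 := by linarith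
  rw [parabolicCylinderD, hα, (isWhittakerW_whittakerW hlt.le).unique (isWhittakerW_integral hlt)]
  beta_reduce
  rw [if_pos (by positivity), show 1 / 2 - (3 / 4 - a) + 1 / 4 = a by ring,
    show -(1 / 2) - (3 / 4 - a) + 1 / 4 = a - 1 by ring,
    show -(1 / 2) + (3 / 4 - a) + 1 / 4 = 1 / 2 - a by ring]
  have h4 : Real.exp (-(z ^ 2 / 2) / 2) = Real.exp (-z ^ 2 / 4) := by ring_nf
  rw [h4]
  generalize (∫ t in Ioi (0 : ℝ), t ^ (a - 1) * (1 + t) ^ (1 / 2 - a) *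
    Real.exp (-(z ^ 2 / 2) * t)) = I
  rw [show z ^ 2 / 2 = z ^ (2 : ℝ) * 2⁻¹ by norm_num [div_eq_mul_inv],
    Real.mul_rpow (by positivity) (by positivity), ← Real.rpow_mul hz.le,
    Real.inv_rpow (by norm_num), ← Real.rpow_neg (by norm_num)]
  have h2 : (2 : ℝ) ^ (3 / 4 - a) * 2 ^ (-(1 / 2 + 1 / 4) : ℝ) = 2 ^ (-a) := by
    rw [← Real.rpow_add (by norm_num)]; congr 1; ring
  have h3 : z ^ (-(1 / 2) : ℝ) * z ^ (2 * (1 / 2 + 1 / 4) : ℝ) = z := by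
    rw [← Real.rpow_add hz]; norm_num
  calc _ = (2 ^ (3 / 4 - a) * 2 ^ (-(1 / 2 + 1 / 4) : ℝ)) *
        (z ^ (-(1 / 2) : ℝ) * z ^ (2 * (1 / 2 + 1 / 4) : ℝ)) * Real.exp (-z ^ 2 / 4) *
        (Real.Gamma a)⁻¹ * I := by ring
    _ = _ := by rw [h2, h3]

/-! ### Symmetry and formulas for the kernel -/

/-- The kernel depends on its arguments only through elementary symmetric polynomials. This swap and
the rotation below carry one marginal bound to the other two. -/
theorem whittakerKernel_swap (a x y ξ : ℝ) : whittakerKernel a x y ξ = whittakerKernel a x ξ y := by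
  unfold whittakerKernel
  rw [show x * ξ * y = x * y * ξ by ring, show x * ξ + x * y + ξ * y = x * y + x * ξ + y * ξ by ring,
    show x + ξ + y = x + y + ξ by ring, show 8 * x * ξ * y = 8 * x * y * ξ by ring,
    show 2 * x * ξ * y = 2 * x * y * ξ by ring]

theorem whittakerKernel_rotate (a x y ξ : ℝ) :
    whittakerKernel a x y ξ = whittakerKernel a y ξ x := by
  unfold whittakerKernel
  rw [show y * ξ * x = x * y * ξ by ring, show y * ξ + y * x + ξ * x = x * y + x * ξ + y * ξ by ring,
    show y + ξ + x = x + y + ξ by ring, show 8 * y * ξ * x = 8 * x * y * ξ by ring,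
    show 2 * y * ξ * x = 2 * x * y * ξ by ring]

theorem whittakerKernel_zero {x y ξ : ℝ} (hx : 0 < x) (hy : 0 < y) (hξ : 0 < ξ) :
    whittakerKernel 0 x y ξ = (4 * √Real.pi * √(x * y * ξ))⁻¹ * (x * y + x * ξ + y * ξ) *
      Real.exp (x + y + ξ - (x * y + x * ξ + y * ξ) ^ 2 / (4 * (x * y * ξ))) := by
  have hP : 0 < x * y * ξ := by positivity
  have hS : 0 < x * y + x * ξ + y * ξ := by positivity
  unfold whittakerKernel
  rw [show 8 * x * y * ξ = 8 * (x * y * ξ) by ring, show 2 * x * y * ξ = 2 * (x * y * ξ) by ring]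
  generalize x * y * ξ = P at *
  generalize x * y + x * ξ + y * ξ = S at *
  rw [mul_zero, sub_zero, parabolicCylinderD_one (by positivity), ← Real.sqrt_eq_rpow, div_pow,
    Real.sq_sqrt (by positivity), Real.rpow_zero, Real.rpow_neg Real.pi_pos.le,
    ← Real.sqrt_eq_rpow, add_zero, Real.sqrt_mul (by norm_num)]
  have e1 : (2 : ℝ) ^ (-(3 / 2) : ℝ) = (2 * √2)⁻¹ := by
    rw [Real.rpow_neg (by norm_num), show (3 / 2 : ℝ) = 1 + 1 / 2 by norm_num,
      Real.rpow_add (by norm_num), Real.rpow_one, ← Real.sqrt_eq_rpow]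
  -- With `z² = S²/(2P)`, the factor `exp(-z²/4)` of `D_1` contributes a second `S²/(8P)`, doubling
  -- the one in the kernel.
  have e2 : Real.exp (x + y + ξ - S ^ 2 / (4 * P)) =
      Real.exp (x + y + ξ - S ^ 2 / (8 * P)) * Real.exp (-(S ^ 2 / (2 * P)) / 4) := by
    rw [← Real.exp_add]; congr 1; field_simp; ring
  have e3 : √2 * √2 = (2 : ℝ) := Real.mul_self_sqrt (by norm_num)
  rw [e1, e2, show (4 : ℝ) * √Real.pi * √P = (2 * √2 * √2) * √Real.pi * √P by
    rw [mul_assoc 2, e3]; norm_num]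
  field_simp

theorem whittakerKernel_eq_integral {a x y ξ : ℝ} (ha : 0 < a) (hx : 0 < x) (hy : 0 < y)
    (hξ : 0 < ξ) :
    whittakerKernel a x y ξ = (4 * √Real.pi * √(x * y * ξ) * Real.Gamma a)⁻¹ * (x * y * ξ) ^ a *
      (x * y + x * ξ + y * ξ) * Real.exp (x + y + ξ) *
      ∫ t in Ioi (0 : ℝ), t ^ (a - 1) * (1 + t) ^ (1 / 2 - a) *
        Real.exp (-((x * y + x * ξ + y * ξ) ^ 2 / (4 * (x * y * ξ))) * (1 + t)) := by
  have hP : 0 < x * y * ξ := by positivity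
  have hS : 0 < x * y + x * ξ + y * ξ := by positivity
  unfold whittakerKernel
  rw [show 8 * x * y * ξ = 8 * (x * y * ξ) by ring, show 2 * x * y * ξ = 2 * (x * y * ξ) by ring]
  generalize x * y * ξ = P at *
  generalize x * y + x * ξ + y * ξ = S at *
  rw [parabolicCylinderD_eq_integral ha (by positivity), ← Real.sqrt_eq_rpow, div_pow,
    Real.sq_sqrt (by positivity), Real.rpow_neg Real.pi_pos.le,
    ← Real.sqrt_eq_rpow, Real.sqrt_mul (by norm_num)]
  have hc : S ^ 2 / (2 * P) / 2 = S ^ 2 / (4 * P) := by field_simp; ring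
  rw [hc]
  set c := S ^ 2 / (4 * P) with hcd
  have e0 : ∀ t : ℝ, t ^ (a - 1) * (1 + t) ^ (1 / 2 - a) * Real.exp (-c * (1 + t)) =
      Real.exp (-c) * (t ^ (a - 1) * (1 + t) ^ (1 / 2 - a) * Real.exp (-c * t)) := by
    intro t
    rw [mul_add, mul_one, Real.exp_add]; ring
  simp only [e0]
  rw [integral_const_mul]
  generalize (∫ t in Ioi (0 : ℝ), t ^ (a - 1) * (1 + t) ^ (1 / 2 - a) * Real.exp (-c * t)) = I
  have e1 : (2 : ℝ) ^ (-(3 / 2) + a : ℝ) = (2 * √2)⁻¹ * 2 ^ a := by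
    rw [Real.rpow_add (by norm_num), Real.rpow_neg (by norm_num),
      show (3 / 2 : ℝ) = 1 + 1 / 2 by norm_num,
      Real.rpow_add (by norm_num), Real.rpow_one, ← Real.sqrt_eq_rpow]
  have e2 : Real.exp (x + y + ξ) * Real.exp (-c) =
      Real.exp (x + y + ξ - S ^ 2 / (8 * P)) * Real.exp (-(S ^ 2 / (2 * P)) / 4) := by
    rw [← Real.exp_add, ← Real.exp_add]; congr 1; rw [hcd]; field_simp; ring
  have e3 : √2 * √2 = (2 : ℝ) := Real.mul_self_sqrt (by norm_num)
  have e4 : (2 : ℝ) ^ a ≠ 0 := by positivity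
  have hΓ := (Real.Gamma_pos_of_pos ha).ne'
  rw [← mul_assoc _ (Real.exp (-c)) I, mul_assoc _ (Real.exp (x + y + ξ)), e2, e1,
    Real.rpow_neg (by norm_num),
    show (4 : ℝ) * √Real.pi * √P = (2 * √2 * √2) * √Real.pi * √P by
    rw [mul_assoc 2, e3]; norm_num]
  field_simp

/-! ### The marginal bound -/

theorem lintegral_whittakerKernel_zero_le {x y : ℝ} (hx : 0 < x) (hy : 0 < y) :
    ∫⁻ ξ in Ioi 0, ENNReal.ofReal (whittakerKernel 0 x y ξ * whittakerWeight 0 ξ) ≤ 1 := by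
  have hA : 0 < x * y := by positivity
  have hB : 0 < x + y := by positivity
  -- From `(A + Bξ)² = (A - Bξ)² + 4ABξ` with `A = xy`, `B = x + y`, the exponent of kernel times
  -- weight is exactly `-v²/(4A)`. The linear factor `A + Bξ` coming from `D_1` is the numerator of
  -- the Jacobian.
  set v : ℝ → ℝ := fun ξ => (x * y - (x + y) * ξ) / √ξ with hv
  set v' : ℝ → ℝ := fun ξ => -((x * y + (x + y) * ξ) / (2 * ξ * √ξ)) with hv'
  have dv : ∀ ξ ∈ Ioi (0 : ℝ), HasDerivAt v (v' ξ) ξ := by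
    intro ξ hξ
    have hξ : 0 < ξ := hξ
    have h1 : HasDerivAt (fun ξ : ℝ => x * y - (x + y) * ξ) (-((x + y) * 1)) ξ :=
      ((hasDerivAt_id ξ).const_mul (x + y)).const_sub (x * y)
    refine (h1.div (Real.hasDerivAt_sqrt hξ.ne') (by positivity)).congr_deriv ?_
    have h2 := Real.sq_sqrt hξ.le
    have h3 : 0 < √ξ := Real.sqrt_pos.2 hξ
    simp only [hv']
    field_simp
    rw [h2]; ring
  have hneg : ∀ ξ ∈ Ioi (0 : ℝ), v' ξ < 0 := by
    intro ξ hξ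
    have hξ : 0 < ξ := hξ
    simp only [hv', neg_lt_zero]
    positivity
  have hinj : InjOn v (Ioi 0) := by
    refine (strictAntiOn_of_hasDerivWithinAt_neg (f' := v') (convex_Ioi 0)
      (fun ξ hξ => (dv ξ hξ).continuousAt.continuousWithinAt) ?_ ?_).injOn
    · rw [interior_Ioi]; exact fun ξ hξ => (dv ξ hξ).hasDerivWithinAt
    · rw [interior_Ioi]; exact hneg
  have key := setLIntegral_abs_deriv_mul_comp_le measurableSet_Ioi dv hinj (mapsTo_univ _ _)
    (fun w => ENNReal.ofReal (2 * √Real.pi * √(x * y))⁻¹ *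
      ENNReal.ofReal (Real.exp (-(4 * (x * y))⁻¹ * w ^ 2)))
  rw [Measure.restrict_univ, lintegral_const_mul _ (by fun_prop),
    lintegral_exp_neg_mul_sq (by positivity), ← ENNReal.ofReal_mul (by positivity)] at key
  have hone : (2 * √Real.pi * √(x * y))⁻¹ * √(Real.pi / (4 * (x * y))⁻¹) = 1 := by
    have h4 : √(4 : ℝ) = 2 := by
      rw [show (4 : ℝ) = 2 ^ 2 by norm_num, Real.sqrt_sq (by norm_num)]
    rw [div_inv_eq_mul, Real.sqrt_mul Real.pi_pos.le, Real.sqrt_mul (by norm_num) (x * y), h4]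
    have h5 : √Real.pi ≠ 0 := (Real.sqrt_pos.2 Real.pi_pos).ne'
    have h6 : √(x * y) ≠ 0 := (Real.sqrt_pos.2 hA).ne'
    field_simp
  rw [hone, ENNReal.ofReal_one] at key
  refine (setLIntegral_congr_fun measurableSet_Ioi fun ξ hξ => ?_).trans_le key
  have hneg' := hneg ξ hξ
  have hξ : 0 < ξ := hξ
  rw [← ENNReal.ofReal_mul (by positivity), ← ENNReal.ofReal_mul (abs_nonneg _),
    whittakerKernel_zero hx hy hξ, whittakerWeight, abs_of_neg hneg']
  congr 1
  have hw : ξ ^ (-2 * 0 - 1 : ℝ) = ξ⁻¹ := by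
    rw [show (-2 * 0 - 1 : ℝ) = -1 by norm_num, Real.rpow_neg_one]
  have he : Real.exp (x + y + ξ - (x * y + x * ξ + y * ξ) ^ 2 / (4 * (x * y * ξ))) * Real.exp (-ξ) =
      Real.exp (-(4 * (x * y))⁻¹ * v ξ ^ 2) := by
    rw [← Real.exp_add]
    congr 1
    simp only [hv, div_pow, Real.sq_sqrt hξ.le]
    field_simp
    ring
  rw [hw, ← he, Real.sqrt_mul hA.le]
  simp only [hv', neg_neg]
  field_simp
  ring

/-- The truncated power `s₊^{a-1}`. -/
noncomputable def posRpow (a s : ℝ) : ℝ≥0∞ :=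
  (Ioi 0).indicator (fun s => ENNReal.ofReal (s ^ (a - 1))) s

@[fun_prop]
theorem measurable_posRpow (a : ℝ) : Measurable (posRpow a) :=
  (by fun_prop : Measurable fun s : ℝ => ENNReal.ofReal (s ^ (a - 1))).indicator measurableSet_Ioi

theorem posRpow_mul (a : ℝ) {c : ℝ} (hc : 0 < c) (s : ℝ) :
    posRpow a (c * s) = ENNReal.ofReal (c ^ (a - 1)) * posRpow a s := by
  unfold posRpow
  rcases lt_or_ge 0 s with hs | hs
  · rw [indicator_of_mem (show c * s ∈ Ioi 0 from mul_pos hc hs),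
      indicator_of_mem (show s ∈ Ioi 0 from hs), ← ENNReal.ofReal_mul (by positivity),
      Real.mul_rpow hc.le hs.le]
  · rw [indicator_of_notMem (by simpa using mul_nonpos_of_nonneg_of_nonpos hc.le hs),
      indicator_of_notMem (by simpa using hs), mul_zero]

theorem lintegral_exp_neg_mul_posRpow {a : ℝ} (ha : 0 < a) (d : ℝ) :
    ∫⁻ s, ENNReal.ofReal (Real.exp (-s)) * posRpow a (s - d) =
      ENNReal.ofReal (Real.exp (-d) * Real.Gamma a) := by
  have h := lintegral_sub_right_eq_self (μ := (volume : Measure ℝ))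
    (fun s => ENNReal.ofReal (Real.exp (-(s + d))) * posRpow a s) d
  simp only [sub_add_cancel] at h
  rw [h, Real.Gamma_eq_integral ha, ENNReal.ofReal_mul (Real.exp_pos _).le,
    ofReal_integral_eq_lintegral_ofReal (Real.GammaIntegral_convergent ha)
      (by
        filter_upwards [ae_restrict_mem measurableSet_Ioi] with s hs
        have hs : 0 < s := hs
        positivity),
    ← lintegral_const_mul _ (by fun_prop), ← lintegral_indicator measurableSet_Ioi]
  refine lintegral_congr fun s => ?_
  unfold posRpow
  by_cases hs : s ∈ Ioi (0 : ℝ)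
  · have hs0 : 0 < s := hs
    rw [indicator_of_mem hs, indicator_of_mem hs, neg_add, Real.exp_add,
      ← ENNReal.ofReal_mul (by positivity), ← ENNReal.ofReal_mul (by positivity)]
    congr 1
    ring
  · rw [indicator_of_notMem hs, indicator_of_notMem hs, mul_zero]

/-- Substituting `s = c(1 + t)` frees the exponential from `c`, which is left only in the truncation
and in a prefactor `(√c)⁻¹`; the other powers of `c` cancel. -/
theorem ofReal_integral_rpow_mul_one_add_rpow_le {a c : ℝ} (ha : 0 < a) (hc : 0 < c) :
    ENNReal.ofReal (∫ t in Ioi (0 : ℝ), t ^ (a - 1) * (1 + t) ^ (1 / 2 - a) *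
        Real.exp (-c * (1 + t))) ≤
      ∫⁻ s in Ioi 0, posRpow a (s - c) *
        ENNReal.ofReal ((√c)⁻¹ * s ^ (1 / 2 - a) * Real.exp (-s)) := by
  have hint : IntegrableOn (fun t : ℝ => t ^ (a - 1) * (1 + t) ^ (1 / 2 - a) *
      Real.exp (-c * (1 + t))) (Ioi 0) := by
    refine ((integrableOn_rpow_mul_one_add_rpow_mul_exp (p := a - 1) (k := 1 / 2 - a)
      (by linarith) hc).const_mul (Real.exp (-c))).congr (ae_of_all _ fun t => ?_)
    beta_reduce
    rw [mul_add, mul_one, Real.exp_add]; ring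
  rw [ofReal_integral_eq_lintegral_ofReal hint
    (by
      filter_upwards [ae_restrict_mem measurableSet_Ioi] with t ht
      have ht : 0 < t := ht
      positivity)]
  have dv : ∀ t ∈ Ioi (0 : ℝ), HasDerivAt (fun t => c * (1 + t)) ((fun _ => c) t) t := by
    intro t _
    simpa using ((hasDerivAt_id t).const_add 1).const_mul c
  have key := setLIntegral_abs_deriv_mul_comp_le (t := Ioi 0) measurableSet_Ioi dv
    (fun t _ u _ h => by simpa [hc.ne'] using h)
    (fun t ht => mul_pos hc (by linarith [mem_Ioi.1 ht]))
    (fun s => posRpow a (s - c) * ENNReal.ofReal ((√c)⁻¹ * s ^ (1 / 2 - a) * Real.exp (-s)))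
  refine (setLIntegral_congr_fun measurableSet_Ioi fun t ht => ?_).trans_le key
  have ht0 : 0 < t := ht
  have h1t : 0 < 1 + t := by linarith
  rw [show c * (1 + t) - c = c * t by ring, posRpow_mul a hc, posRpow, indicator_of_mem ht,
    abs_of_pos hc, ← ENNReal.ofReal_mul (by positivity), ← ENNReal.ofReal_mul (by positivity),
    ← ENNReal.ofReal_mul (by positivity), Real.mul_rpow hc.le h1t.le, neg_mul]
  congr 1
  have e : c * c ^ (a - 1) * (√c)⁻¹ * c ^ (1 / 2 - a) = 1 := by
    rw [Real.sqrt_eq_rpow, ← Real.rpow_neg hc.le, ← Real.rpow_one_add' hc.le (by linarith),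
      ← Real.rpow_add hc, ← Real.rpow_add hc,
      show 1 + (a - 1) + -(1 / 2) + (1 / 2 - a) = 0 by ring, Real.rpow_zero]
  linear_combination -(t ^ (a - 1) * (1 + t) ^ (1 / 2 - a) * Real.exp (-(c * (1 + t)))) * e

/-- Since `S = 2√c √(xyξ)`, the factor `S` of the kernel cancels both `√(xyξ)` and the `(√c)⁻¹` of
the previous substitution. Now `ξ` enters only through a pure power and the truncated power. -/
theorem ofReal_whittakerKernel_mul_whittakerWeight_le {a x y ξ : ℝ} (ha : 0 < a) (hx : 0 < x)
    (hy : 0 < y) (hξ : 0 < ξ) :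
    ENNReal.ofReal (whittakerKernel a x y ξ * whittakerWeight a ξ) ≤
      ∫⁻ s in Ioi 0, posRpow a (s - (x * y + x * ξ + y * ξ) ^ 2 / (4 * (x * y * ξ))) *
        ENNReal.ofReal (Real.exp (x + y) * (2 * √Real.pi * Real.Gamma a)⁻¹ *
          ((x * y) ^ a * ξ ^ (-a - 1)) * (s ^ (1 / 2 - a) * Real.exp (-s))) := by
  have hA : 0 < x * y := by positivity
  have hS : 0 < x * y + x * ξ + y * ξ := by positivity
  have hΓ := Real.Gamma_pos_of_pos ha
  rw [whittakerKernel_eq_integral ha hx hy hξ, whittakerWeight]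
  set S := x * y + x * ξ + y * ξ
  set c := S ^ 2 / (4 * (x * y * ξ)) with hc
  have hc0 : 0 < c := by positivity
  have hP : 0 < x * y * ξ := by positivity
  set J := ∫ t in Ioi (0 : ℝ), t ^ (a - 1) * (1 + t) ^ (1 / 2 - a) * Real.exp (-c * (1 + t)) with hJ
  have hsq : S = 2 * √c * √(x * y * ξ) := by
    have h4 : √(4 : ℝ) = 2 := by
      rw [show (4 : ℝ) = 2 ^ 2 by norm_num, Real.sqrt_sq (by norm_num)]
    rw [hc, Real.sqrt_div (by positivity), Real.sqrt_sq hS.le, Real.sqrt_mul (by norm_num), h4]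
    field_simp
  set D := Real.exp (x + y) * (2 * √Real.pi * Real.Gamma a)⁻¹ * ((x * y) ^ a * ξ ^ (-a - 1)) with hD
  have hD0 : 0 < D := by positivity
  have heq : (4 * √Real.pi * √(x * y * ξ) * Real.Gamma a)⁻¹ * (x * y * ξ) ^ a * S *
      Real.exp (x + y + ξ) * J * (ξ ^ (-2 * a - 1) * Real.exp (-ξ)) = D * √c * J := by
    have e1 : ξ ^ (-a - 1) = ξ ^ a * ξ ^ (-2 * a - 1) := by
      rw [← Real.rpow_add hξ]; congr 1; ring
    have e2 : Real.exp (x + y + ξ) * Real.exp (-ξ) = Real.exp (x + y) := by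
      rw [← Real.exp_add]; congr 1; ring
    rw [hD, e1, ← e2, Real.mul_rpow hA.le hξ.le]
    nth_rewrite 1 [hsq]
    field_simp
    ring
  rw [heq, ENNReal.ofReal_mul (by positivity)]
  refine (mul_le_mul_right (ofReal_integral_rpow_mul_one_add_rpow_le ha hc0) _).trans_eq ?_
  rw [← lintegral_const_mul _ (by fun_prop)]
  refine setLIntegral_congr_fun measurableSet_Ioi fun s hs => ?_
  have hs : 0 < s := hs
  rw [mul_left_comm (ENNReal.ofReal _), ← ENNReal.ofReal_mul (by positivity)]
  congr 2
  have : √c ≠ 0 := (Real.sqrt_pos.2 hc0).ne'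
  field_simp

/-- With `η = xy/ξ` and `B = x + y` the truncation point is `c = (η + B)²/(4η)`. Completing the
square in `η` gives `s - c = (s/η)(s - B - v²)` for `v = (η - 2s + B)/(2√s)`. By homogeneity of the
truncated power, what remains is twice the Jacobian. -/
theorem lintegral_posRpow_mul_rpow_le {a x y s : ℝ} (hx : 0 < x) (hy : 0 < y)
    (hs : 0 < s) :
    ∫⁻ ξ in Ioi 0, posRpow a (s - (x * y + x * ξ + y * ξ) ^ 2 / (4 * (x * y * ξ))) *
        ENNReal.ofReal ((x * y) ^ a * ξ ^ (-a - 1) * s ^ (1 / 2 - a)) ≤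
      ∫⁻ v, 2 * posRpow a (s - (x + y + v ^ 2)) := by
  have hA : 0 < x * y := by positivity
  have hr : 0 < √s := Real.sqrt_pos.2 hs
  have hr2 : √s ^ 2 = s := Real.sq_sqrt hs.le
  have dv : ∀ ξ ∈ Ioi (0 : ℝ), HasDerivAt (fun ξ => (x * y * ξ⁻¹ - 2 * s + (x + y)) / (2 * √s))
      ((fun ξ => x * y * (-(ξ ^ 2)⁻¹) / (2 * √s)) ξ) ξ := by
    intro ξ hξ
    have hξ : 0 < ξ := hξ
    exact ((((hasDerivAt_inv hξ.ne').const_mul (x * y)).sub_const _).add_const _).div_const _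
  have key := setLIntegral_abs_deriv_mul_comp_le measurableSet_Ioi dv
    (fun ξ _ η _ h => by
      rw [div_left_inj' (by positivity), add_left_inj, sub_left_inj] at h
      exact inv_injective (mul_left_cancel₀ hA.ne' h))
    (mapsTo_univ _ _) (fun v => 2 * posRpow a (s - (x + y + v ^ 2)))
  rw [Measure.restrict_univ] at key
  refine (setLIntegral_congr_fun measurableSet_Ioi fun ξ hξ => ?_).trans_le key
  have hξ : 0 < ξ := hξ
  have e1 : s - (x * y + x * ξ + y * ξ) ^ 2 / (4 * (x * y * ξ)) = (s * ξ / (x * y)) *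
      (s - (x + y + ((x * y * ξ⁻¹ - 2 * s + (x + y)) / (2 * √s)) ^ 2)) := by
    rw [div_pow, mul_pow, hr2]
    field_simp
    ring
  have e2 : |x * y * (-(ξ ^ 2)⁻¹) / (2 * √s)| = x * y * (ξ ^ 2)⁻¹ / (2 * √s) := by
    rw [mul_neg, neg_div, abs_neg, abs_of_pos (by positivity)]
  rw [e1, posRpow_mul a (by positivity), e2, mul_right_comm (ENNReal.ofReal _),
    ← ENNReal.ofReal_mul (by positivity), ← mul_assoc (ENNReal.ofReal _), show (2 : ℝ≥0∞) = ENNReal.ofReal 2 by simp, ← ENNReal.ofReal_mul (by positivity)]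
  congr 2
  rw [Real.div_rpow (by positivity) hA.le, Real.mul_rpow hs.le hξ.le, Real.sqrt_eq_rpow]
  have f1 : (x * y) ^ a = (x * y) ^ (a - 1) * (x * y) := by
    rw [← Real.rpow_add_one hA.ne']; ring_nf
  have f2 : ξ ^ (a - 1) * ξ ^ (-a - 1) = (ξ ^ 2)⁻¹ := by
    rw [← Real.rpow_add hξ, show a - 1 + (-a - 1) = -(2 : ℕ) by push_cast; ring,
      Real.rpow_neg hξ.le, Real.rpow_natCast]
  have f3 : s ^ (a - 1) * s ^ (1 / 2 - a) = (s ^ (1 / 2 : ℝ))⁻¹ := by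
    rw [← Real.rpow_add hs, ← Real.rpow_neg hs.le]; congr 1; ring
  rw [f1]
  calc _ = ((x * y) ^ (a - 1) / (x * y) ^ (a - 1)) * (x * y) * (ξ ^ (a - 1) * ξ ^ (-a - 1)) *
        (s ^ (a - 1) * s ^ (1 / 2 - a)) := by ring
    _ = _ := by
      rw [div_self (by positivity), f2, f3]
      field_simp

theorem lintegral_whittakerKernel_le {a x y : ℝ} (ha : 0 ≤ a) (hx : 0 < x) (hy : 0 < y) :
    ∫⁻ ξ in Ioi 0, ENNReal.ofReal (whittakerKernel a x y ξ * whittakerWeight a ξ) ≤ 1 := by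
  rcases ha.eq_or_lt with rfl | ha
  · exact lintegral_whittakerKernel_zero_le hx hy
  have hΓ := Real.Gamma_pos_of_pos ha
  set C := Real.exp (x + y) * (2 * √Real.pi * Real.Gamma a)⁻¹ with hC
  have hC0 : 0 < C := by positivity
  set c : ℝ → ℝ := fun ξ => (x * y + x * ξ + y * ξ) ^ 2 / (4 * (x * y * ξ)) with hc
  have hcm : Measurable c := by simp only [hc]; fun_prop
  calc ∫⁻ ξ in Ioi 0, ENNReal.ofReal (whittakerKernel a x y ξ * whittakerWeight a ξ)
      ≤ ∫⁻ ξ in Ioi 0, ∫⁻ s in Ioi 0, posRpow a (s - c ξ) *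
        ENNReal.ofReal (C * ((x * y) ^ a * ξ ^ (-a - 1)) * (s ^ (1 / 2 - a) * Real.exp (-s))) :=
        setLIntegral_mono' measurableSet_Ioi fun ξ hξ =>
          ofReal_whittakerKernel_mul_whittakerWeight_le ha hx hy hξ
    _ = ∫⁻ s in Ioi 0, ∫⁻ ξ in Ioi 0, posRpow a (s - c ξ) *
        ENNReal.ofReal (C * ((x * y) ^ a * ξ ^ (-a - 1)) * (s ^ (1 / 2 - a) * Real.exp (-s))) := by
        refine lintegral_lintegral_swap (Measurable.aemeasurable ?_)
        refine ((measurable_posRpow a).comp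
          (measurable_snd.sub (hcm.comp measurable_fst))).mul ?_
        fun_prop
    _ ≤ ∫⁻ s in Ioi 0, ∫⁻ v : ℝ, ENNReal.ofReal (2 * C) *
          (ENNReal.ofReal (Real.exp (-s)) * posRpow a (s - (x + y + v ^ 2))) := by
        refine setLIntegral_mono' measurableSet_Ioi fun s hs => ?_
        have hs : 0 < s := hs
        have hm : Measurable fun ξ => posRpow a (s - c ξ) *
            ENNReal.ofReal ((x * y) ^ a * ξ ^ (-a - 1) * s ^ (1 / 2 - a)) :=
          ((measurable_posRpow a).comp (hcm.const_sub s)).mul (by fun_prop)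
        have hm' : Measurable fun v : ℝ => 2 * posRpow a (s - (x + y + v ^ 2)) :=
          ((measurable_posRpow a).comp (by fun_prop)).const_mul 2
        calc ∫⁻ ξ in Ioi 0, posRpow a (s - c ξ) * ENNReal.ofReal
              (C * ((x * y) ^ a * ξ ^ (-a - 1)) * (s ^ (1 / 2 - a) * Real.exp (-s)))
            = ENNReal.ofReal (C * Real.exp (-s)) * ∫⁻ ξ in Ioi 0, posRpow a (s - c ξ) *
              ENNReal.ofReal ((x * y) ^ a * ξ ^ (-a - 1) * s ^ (1 / 2 - a)) := by
              rw [← lintegral_const_mul _ hm]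
              refine lintegral_congr fun ξ => ?_
              rw [mul_left_comm (ENNReal.ofReal _), ← ENNReal.ofReal_mul (by positivity)]
              congr 2
              ring
          _ ≤ ENNReal.ofReal (C * Real.exp (-s)) *
              ∫⁻ v, 2 * posRpow a (s - (x + y + v ^ 2)) :=
              mul_le_mul_right (lintegral_posRpow_mul_rpow_le hx hy hs) _
          _ = _ := by
              rw [← lintegral_const_mul _ hm']
              refine lintegral_congr fun v => ?_
              rw [ENNReal.ofReal_mul hC0.le, ENNReal.ofReal_mul (p := 2) (by norm_num),
                ENNReal.ofReal_ofNat]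
              ring
    -- Nothing is lost here: the truncated power vanishes unless `s > x + y + v² > 0`.
    _ ≤ ∫⁻ s, ∫⁻ v : ℝ, ENNReal.ofReal (2 * C) *
          (ENNReal.ofReal (Real.exp (-s)) * posRpow a (s - (x + y + v ^ 2))) :=
        setLIntegral_le_lintegral _ _
    _ = ∫⁻ v : ℝ, ∫⁻ s, ENNReal.ofReal (2 * C) *
          (ENNReal.ofReal (Real.exp (-s)) * posRpow a (s - (x + y + v ^ 2))) := by
        refine lintegral_lintegral_swap (Measurable.aemeasurable ?_)
        exact Measurable.const_mul (Measurable.mul (by fun_prop)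
          ((measurable_posRpow a).comp (by fun_prop))) _
    _ = ∫⁻ v : ℝ, ENNReal.ofReal (2 * C * (Real.exp (-(x + y)) * Real.Gamma a)) *
          ENNReal.ofReal (Real.exp (-1 * v ^ 2)) := by
        refine lintegral_congr fun v => ?_
        rw [lintegral_const_mul _ (by fun_prop), lintegral_exp_neg_mul_posRpow ha,
          ← ENNReal.ofReal_mul (by positivity), ← ENNReal.ofReal_mul (by positivity), neg_add,
          Real.exp_add, neg_one_mul]
        congr 1
        ring
    _ = 1 := by
        rw [lintegral_const_mul _ (by fun_prop), lintegral_exp_neg_mul_sq one_pos, div_one,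
          ← ENNReal.ofReal_mul (by positivity), ← ENNReal.ofReal_one]
        congr 1
        rw [hC, Real.exp_neg]
        have h5 : √Real.pi ≠ 0 := (Real.sqrt_pos.2 Real.pi_pos).ne'
        field_simp

/-! ### The weighted measure, measurability and positivity -/

instance (a : ℝ) : SigmaFinite (whittakerMeasure a) :=
  SigmaFinite.withDensity_ofReal _

theorem measurable_whittakerWeight (a : ℝ) : Measurable (whittakerWeight a) := by
  unfold whittakerWeight; fun_prop

theorem lintegral_whittakerMeasure (a : ℝ) (h : ℝ → ℝ≥0∞) (hh : Measurable h) :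
    ∫⁻ ξ, h ξ ∂(whittakerMeasure a) =
      ∫⁻ ξ in Ioi 0, h ξ * ENNReal.ofReal (whittakerWeight a ξ) := by
  rw [whittakerMeasure, lintegral_withDensity_eq_lintegral_mul _
    (measurable_whittakerWeight a).ennreal_ofReal hh]
  simp only [Pi.mul_apply, mul_comm]

/-- The density is positive on the half-line, so the null sets are those of Lebesgue measure there.
-/
theorem ae_whittakerMeasure_iff (a : ℝ) {P : ℝ → Prop} :
    (∀ᵐ x ∂(whittakerMeasure a), P x) ↔ ∀ᵐ x ∂(volume.restrict (Ioi (0 : ℝ))), P x := by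
  rw [whittakerMeasure, ae_withDensity_iff (measurable_whittakerWeight a).ennreal_ofReal]
  refine eventually_congr ?_
  filter_upwards [ae_restrict_mem measurableSet_Ioi] with x hx
  have hx : 0 < x := hx
  have : 0 < whittakerWeight a x := by unfold whittakerWeight; positivity
  simp [this]

theorem ae_pos_whittakerMeasure (a : ℝ) : ∀ᵐ x ∂(whittakerMeasure a), 0 < x :=
  (ae_whittakerMeasure_iff a).2 (ae_restrict_mem measurableSet_Ioi)

/-- Continuity on `(0, ∞)` combines with the convention of vanishing elsewhere. -/
theorem IsWhittakerW.measurable {α ν : ℝ} {u : ℝ → ℝ} (hu : IsWhittakerW α ν u) :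
    Measurable u := by
  have hc : ContinuousOn u (Ioi 0) := fun x hx =>
    (hu.differentiableAt x hx).continuousAt.continuousWithinAt
  have he : u = (Ioi 0).indicator u := by
    funext x
    by_cases hx : x ∈ Ioi (0 : ℝ)
    · rw [indicator_of_mem hx]
    · rw [indicator_of_notMem hx, hu.eq_zero x (not_lt.1 hx)]
  rw [he, ← piecewise_eq_indicator]
  exact hc.measurable_piecewise continuousOn_const measurableSet_Ioi

theorem measurable_parabolicCylinderD {μ : ℝ} (hμ : μ ≤ 1) : Measurable (parabolicCylinderD μ) := by
  have hW : Measurable (whittakerW (μ / 2 + 1 / 4) (1 / 4)) :=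
    (isWhittakerW_whittakerW (by linarith)).measurable
  unfold parabolicCylinderD
  fun_prop

theorem measurable_whittakerKernel {a : ℝ} (ha : 0 ≤ a) :
    Measurable fun w : ℝ × ℝ × ℝ => whittakerKernel a w.1 w.2.1 w.2.2 := by
  have hD : Measurable (parabolicCylinderD (1 - 2 * a)) :=
    measurable_parabolicCylinderD (by linarith)
  unfold whittakerKernel
  fun_prop

theorem whittakerKernel_nonneg {a x y ξ : ℝ} (ha : 0 ≤ a) (hx : 0 < x) (hy : 0 < y) (hξ : 0 < ξ) :
    0 ≤ whittakerKernel a x y ξ := by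
  rcases ha.eq_or_lt with rfl | ha
  · rw [whittakerKernel_zero hx hy hξ]; positivity
  · rw [whittakerKernel_eq_integral ha hx hy hξ]
    have hΓ := Real.Gamma_pos_of_pos ha
    refine mul_nonneg (by positivity) (setIntegral_nonneg measurableSet_Ioi fun t ht => ?_)
    have ht : 0 < t := ht
    positivity

theorem lintegral_enorm_whittakerKernel_le {a x y : ℝ} (ha : 0 ≤ a) (hx : 0 < x) (hy : 0 < y) :
    ∫⁻ ξ, ‖(whittakerKernel a x y ξ : ℂ)‖ₑ ∂(whittakerMeasure a) ≤ 1 := by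
  have hm : Measurable fun ξ => whittakerKernel a x y ξ :=
    (measurable_whittakerKernel ha).comp
      (measurable_const.prodMk (measurable_const.prodMk measurable_id))
  rw [lintegral_whittakerMeasure a _ (by fun_prop)]
  refine (setLIntegral_congr_fun measurableSet_Ioi fun ξ hξ => ?_).trans_le
    (lintegral_whittakerKernel_le ha hx hy)
  have hq := whittakerKernel_nonneg ha hx hy hξ
  rw [ENNReal.ofReal_mul hq, ← ofReal_norm, Complex.norm_real, Real.norm_of_nonneg hq]

/-! ### The convolution -/

theorem whittakerConv_congr {a : ℝ} {f f' g g' : ℝ → ℂ} (hf : f =ᵐ[whittakerMeasure a] f')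
    (hg : g =ᵐ[whittakerMeasure a] g') : whittakerConv a f g = whittakerConv a f' g' := by
  funext x
  refine integral_congr_ae ?_
  filter_upwards [hg] with ξ hξ
  refine integral_congr_ae ?_
  filter_upwards [hf] with y hy
  rw [hξ, hy]

theorem WhittakerConvExists.congr {a : ℝ} {f f' g g' : ℝ → ℂ} (hf : f =ᵐ[whittakerMeasure a] f')
    (hg : g =ᵐ[whittakerMeasure a] g') (h : WhittakerConvExists a f g) :
    WhittakerConvExists a f' g' := by
  filter_upwards [h] with x hx
  refine hx.congr ?_
  filter_upwards [Measure.quasiMeasurePreserving_fst.ae hf,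
    Measure.quasiMeasurePreserving_snd.ae hg] with w hw1 hw2
  rw [hw1, hw2]

/-- The abstract inequality is applied to `T`, the convolution of absolute values. Finiteness of its
norm yields existence almost everywhere, and `T` dominates the convolution. -/
theorem whittakerConv_young_of_stronglyMeasurable {a : ℝ} (ha : 0 ≤ a) {p₁ p₂ r : ℝ≥0∞}
    (hp₁ : 1 ≤ p₁) (hp₂ : 1 ≤ p₂) (hp : 1 ≤ 1 / p₁ + 1 / p₂) (hr : 1 / r = 1 / p₁ + 1 / p₂ - 1)
    {f g : ℝ → ℂ} (hf : MemLp f p₁ (whittakerMeasure a)) (hg : MemLp g p₂ (whittakerMeasure a))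
    (hfm : StronglyMeasurable f) (hgm : StronglyMeasurable g) :
    WhittakerConvExists a f g ∧
      MemLp (whittakerConv a f g) r (whittakerMeasure a) ∧
      eLpNorm (whittakerConv a f g) r (whittakerMeasure a) ≤
        eLpNorm f p₁ (whittakerMeasure a) * eLpNorm g p₂ (whittakerMeasure a) := by
  set μ := whittakerMeasure a with hμ
  have hfm' := hfm.measurable
  have hgm' := hgm.measurable
  have hkm : Measurable fun w : ℝ × ℝ × ℝ => (whittakerKernel a w.1 w.2.1 w.2.2 : ℂ) :=
    (measurable_whittakerKernel ha).complex_ofReal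
  have pos := ae_pos_whittakerMeasure a
  set T : ℝ → ℝ≥0∞ := fun x => ∫⁻ w, ‖(whittakerKernel a x w.1 w.2 : ℂ)‖ₑ * ‖f w.1‖ₑ * ‖g w.2‖ₑ
    ∂(μ.prod μ) with hT
  have young : eLpNorm T r μ ≤ eLpNorm f p₁ μ * eLpNorm g p₂ μ := by
    refine (eLpNorm_lintegral_kernel_le μ μ μ
      (k := fun x y ξ => ‖(whittakerKernel a x y ξ : ℂ)‖ₑ) (F := fun y => ‖f y‖ₑ) (G := fun z => ‖g z‖ₑ)
      hkm.enorm ?_ ?_ ?_ hfm'.enorm hgm'.enorm hp₁ hp₂ hp hr).trans_eq ?_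
    · filter_upwards [pos] with x hx
      filter_upwards [pos] with y hy
      exact lintegral_enorm_whittakerKernel_le ha hx hy
    · filter_upwards [pos] with x hx
      filter_upwards [pos] with z hz
      simp only [whittakerKernel_swap a x _ z]
      exact lintegral_enorm_whittakerKernel_le ha hx hz
    · filter_upwards [pos] with y hy
      filter_upwards [pos] with z hz
      simp only [whittakerKernel_rotate a _ y z]
      exact lintegral_enorm_whittakerKernel_le ha hy hz
    · rw [eLpNorm_enorm, eLpNorm_enorm]
  have hkm4 : Measurable fun w : ℝ × ℝ × ℝ =>
      (whittakerKernel a w.1 w.2.1 w.2.2 : ℂ) * f w.2.1 * g w.2.2 :=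
    (hkm.mul (hfm'.comp (measurable_fst.comp measurable_snd))).mul
      (hgm'.comp (measurable_snd.comp measurable_snd))
  have hTm : Measurable T := by
    have : Measurable fun w : ℝ × ℝ × ℝ =>
        ‖(whittakerKernel a w.1 w.2.1 w.2.2 : ℂ)‖ₑ * ‖f w.2.1‖ₑ * ‖g w.2.2‖ₑ := by fun_prop
    exact this.lintegral_prod_right'
  have hfin : eLpNorm T r μ < ∞ := young.trans_lt (ENNReal.mul_lt_top hf.2 hg.2)
  have hTfin : ∀ᵐ x ∂μ, T x < ∞ := by
    rcases eq_or_ne r ∞ with rfl | hrt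
    · rw [eLpNorm_exponent_top] at hfin
      filter_upwards [enorm_ae_le_eLpNormEssSup T μ] with x hx
      exact lt_of_le_of_lt hx hfin
    · have hr0 : r ≠ 0 := by
        -- In `ℝ≥0∞` one has `1/0 = ∞`, whereas the right side of `hr` is at most 2.
        rintro rfl
        have h1 : 1 / p₁ ≤ 1 := by simpa using hp₁
        have h2 : 1 / p₂ ≤ 1 := by simpa using hp₂
        have h3 : 1 / p₁ + 1 / p₂ - 1 ≤ 1 + 1 := tsub_le_self.trans (add_le_add h1 h2)
        rw [← hr] at h3
        simp at h3
      have hi := lintegral_rpow_enorm_lt_top_of_eLpNorm_lt_top hr0 hrt hfin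
      filter_upwards [ae_lt_top (by fun_prop) hi.ne] with x hx
      by_contra h
      rw [not_lt, top_le_iff] at h
      simp [h, ENNReal.toReal_pos hr0 hrt] at hx
  have hconv : StronglyMeasurable (whittakerConv a f g) := by
    have h1 : StronglyMeasurable fun w : (ℝ × ℝ) × ℝ =>
        (whittakerKernel a w.1.1 w.2 w.1.2 : ℂ) * f w.2 * g w.1.2 :=
      (hkm4.comp (by fun_prop : Measurable fun w : (ℝ × ℝ) × ℝ =>
        (w.1.1, w.2, w.1.2))).stronglyMeasurable
    exact (h1.integral_prod_right' (ν := μ)).integral_prod_right' (ν := μ)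
  -- This holds at every `x`, convergent or not, because a Bochner integral that fails to converge
  -- is 0.
  have hle : ∀ x, ‖whittakerConv a f g x‖ₑ ≤ T x := by
    intro x
    have hm : Measurable fun w : ℝ × ℝ =>
        ‖(whittakerKernel a x w.1 w.2 : ℂ)‖ₑ * ‖f w.1‖ₑ * ‖g w.2‖ₑ := by
      have : Measurable fun w : ℝ × ℝ => (whittakerKernel a x w.1 w.2 : ℂ) :=
        hkm.comp (measurable_const.prodMk measurable_id)
      fun_prop
    rw [hT]
    beta_reduce
    rw [lintegral_prod_symm _ hm.aemeasurable]
    refine (enorm_integral_le_lintegral_enorm _).trans (lintegral_mono fun ξ => ?_)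
    refine (enorm_integral_le_lintegral_enorm _).trans_eq (lintegral_congr fun y => ?_)
    rw [enorm_mul, enorm_mul]
  have hnorm : eLpNorm (whittakerConv a f g) r μ ≤ eLpNorm T r μ :=
    eLpNorm_mono_enorm fun x => hle x
  refine ⟨?_, ⟨hconv.aestronglyMeasurable, hnorm.trans_lt hfin⟩, hnorm.trans young⟩
  rw [WhittakerConvExists, ← ae_whittakerMeasure_iff a]
  filter_upwards [hTfin] with x hx
  refine ⟨(hkm4.comp (measurable_const.prodMk measurable_id)).aestronglyMeasurable, ?_⟩
  rw [hasFiniteIntegral_iff_enorm]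
  simpa only [enorm_mul] using hx

theorem mainTheorem8 (a : ℝ) (ha : 0 ≤ a) (p₁ p₂ r : ℝ≥0∞) (hp₁ : 1 ≤ p₁) (hp₂ : 1 ≤ p₂)
    (hp : 1 ≤ 1 / p₁ + 1 / p₂) (hr : 1 / r = 1 / p₁ + 1 / p₂ - 1)
    (f g : ℝ → ℂ) (hf : MemLp f p₁ (whittakerMeasure a)) (hg : MemLp g p₂ (whittakerMeasure a)) :
    WhittakerConvExists a f g ∧
      MemLp (whittakerConv a f g) r (whittakerMeasure a) ∧
      eLpNorm (whittakerConv a f g) r (whittakerMeasure a) ≤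
        eLpNorm f p₁ (whittakerMeasure a) * eLpNorm g p₂ (whittakerMeasure a) := by
  -- Changing `f` and `g` on null sets alters neither their norms nor the convolution at any point,
  -- so strongly measurable representatives suffice.
  have ef := hf.1.ae_eq_mk
  have eg := hg.1.ae_eq_mk
  obtain ⟨h1, h2⟩ := whittakerConv_young_of_stronglyMeasurable ha hp₁ hp₂ hp hr
    ((memLp_congr_ae ef).1 hf) ((memLp_congr_ae eg).1 hg)
    hf.1.stronglyMeasurable_mk hg.1.stronglyMeasurable_mk
  rw [← whittakerConv_congr ef eg, ← eLpNorm_congr_ae ef, ← eLpNorm_congr_ae eg] at h2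
  exact ⟨h1.congr ef.symm eg.symm, h2⟩
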